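/- Fix a dimension $d\ge 1$ and let $\mathcal V=\{\pm e_1,\dots,\pm e_d\}\subset\mathbb R^d$ (Model I), where $e_1,\dots,e_d$ is the canonical basis. For $M\ge 1$ let $\Lambda_M=\{-M,\dots,M\}^d$, and consider configurations $\eta\in(\{0,1\}^{\mathcal V})^{\Lambda_M}$, where $\eta(x,v)\in\{0,1\}$ is the number of particles of velocity $v$ at $x$. Let $$\mathbf I^M(\eta)=\frac1{|\Lambda_M|}\sum_{x\in\Lambda_M}\Big(\sum_{v\in\mathcal V}\eta(x,v),\ \sum_{v\in\mathcal V}v_1\eta(x,v),\ \dots,\ \sum_{v\in\mathcal V}v_d\,\eta(x,v)\Big)\in\mathbb R^{d+1},$$ let $\mathfrak V_M$ be the set of all values of $\mathbf I^M$, and for $\mathbf i\in\mathfrak V_M$ let $\nu_{\Lambda_M,\mathbf i}$ be the uniform probability measure on $\{\eta:\mathbf I^M(\eta)=\mathbf i\}$. Let $\mathcal L_M=\mathcal L_M^{ex}+\mathcal L_M^{c}$, where $$(\mathcal L_M^{ex}f)(\eta)=\frac1{M^{d+2}}\sum_{v\in\mathcal V}\sum_{x,z\in\Lambda_M}\eta(x,v)\,[1-\eta(z,v)]\,[f(\eta^{x,z,v})-f(\eta)],$$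 $$(\mathcal L_M^{c}f)(\eta)=\sum_{y\in\Lambda_M}\sum_{q\in\mathcal Q}p(y,q,\eta)\,[f(\eta^{y,q})-f(\eta)].$$ Here $\eta^{x,z,v}$ is obtained from $\eta$ by exchanging $\eta(x,v)$ and $\eta(z,v)$; $\mathcal Q=\{(v,w,v',w')\in\mathcal V^4: v+w=v'+w'\}$; for $q=(v,w,v',w')$, $p(y,q,\eta)=\eta(y,v)\,\eta(y,w)\,[1-\eta(y,v')]\,[1-\eta(y,w')]$; and $\eta^{y,q}$ is the configuration after the collision $q$ at $y$: with $q=(v_0,v_1,v_2,v_3)$, its value at $(y,v_j)$ is $\eta(y,v_{j+2})$ (indices modulo $4$), and it agrees with $\eta$ elsewhere. Then there is a finite constant $C_2>0$, depending only on $d$ (that is, on $\mathcal V$ and $\mathcal Q$), such that $$E_{\nu_{\Lambda_M,\mathbf i}}[f;f]\ \le\ C_2\,M^{2+3d+2d^2}\,\langle f,-\mathcal L_M f\rangle_{\nu_{\Lambda_M,\mathbf i}}$$ for all $f:(\{0,1\}^{\mathcal V})^{\Lambda_M}\to\mathbb R$, all $\mathbf i\in\mathfrak V_M$ and all $M\ge1$,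 where $E_\nu[f;f]$ is the variance of $f$ under $\nu$ and $\langle\cdot,\cdot\rangle_\nu$ is the scalar product of $L^2(\nu)$. In particular, the inverse spectral gap of $\mathcal L_M$ grows at most polynomially: there are $C_0>0$ and $\kappa>0$, depending only on $d$, such that for all $M\ge1$ and $\mathbf i\in\mathfrak V_M$ there is a constant $C(M,\mathbf i)\le C_0M^\kappa$ with $E_{\nu_{\Lambda_M,\mathbf i}}[f;f]\le C(M,\mathbf i)\,\langle f,-\mathcal L_M f\rangle_{\nu_{\Lambda_M,\mathbf i}}$ for all $f$. -/

import Mathlib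

noncomputable section

namespace LatticeGas

open Finset

/-- The cube `{-M, …, M}^d`. -/
abbrev Box (d M : ℕ) : Type := Fin d → ↥(Finset.Icc (-(M : ℤ)) (M : ℤ))

/-- The velocities `±e_1, …, ±e_d` of Model I, where `e_j` is the canonical basis of `ℝ^d`. -/
def modelI (d : ℕ) : Finset (Fin d → ℝ) :=
  (univ.image fun j : Fin d => (Pi.single j 1 : Fin d → ℝ)) ∪
    (univ.image fun j : Fin d => -(Pi.single j 1 : Fin d → ℝ))

/-- Configurations on the cube with at most one particle per site and velocity:
`η x v = true` means that a particle of velocity `v` sits at `x`. -/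
abbrev Config (d M : ℕ) (V : Finset (Fin d → ℝ)) : Type := Box d M → V → Bool

variable {d M : ℕ} {V : Finset (Fin d → ℝ)}

/-- The occupation number `η(x, v) ∈ {0, 1}`, as a real number. -/
def occ (η : Config d M V) (x : Box d M) (v : V) : ℝ := if η x v then 1 else 0

/-- The conserved quantities at one site: component `0` is the mass `∑_v η(x, v)`,
component `k` (`1 ≤ k ≤ d`) is the momentum `∑_v v_k η(x, v)`. -/
def siteI (η : Config d M V) (x : Box d M) : Fin (d + 1) → ℝ :=
  Fin.cons (∑ v : V, occ η x v) (fun k => ∑ v : V, (v : Fin d → ℝ) k * occ η x v)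

/-- The averages over the cube of the conserved quantities. -/
def avgI (η : Config d M V) : Fin (d + 1) → ℝ :=
  (Fintype.card (Box d M) : ℝ)⁻¹ • ∑ x : Box d M, siteI η x

/-- The set of all possible values of the averages of the conserved quantities. -/
def possibleValues (d M : ℕ) (V : Finset (Fin d → ℝ)) : Set (Fin (d + 1) → ℝ) :=
  Set.range (avgI : Config d M V → Fin (d + 1) → ℝ)

/-- The configurations for which the averages of the conserved quantities equal `i`. -/
def level (d M : ℕ) (V : Finset (Fin d → ℝ)) (i : Fin (d + 1) → ℝ) : Finset (Config d M V) :=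
  univ.filter fun η => avgI η = i

/-- Expectation under the canonical measure, the uniform probability measure on `level d M V i`. -/
def expect (i : Fin (d + 1) → ℝ) (f : Config d M V → ℝ) : ℝ :=
  ((level d M V i).card : ℝ)⁻¹ * ∑ η ∈ level d M V i, f η

/-- Variance under the canonical measure. -/
def variance (i : Fin (d + 1) → ℝ) (f : Config d M V → ℝ) : ℝ :=
  expect i fun η => (f η - expect i f) ^ 2

/-- Scalar product of `L²` of the canonical measure. -/
def innerL2 (i : Fin (d + 1) → ℝ) (f g : Config d M V → ℝ) : ℝ :=
  expect i fun η => f η * g η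

/-- `η^{x,y,v}`: the occupation variables of velocity `v` at `x` and `y` are exchanged. -/
def exchange (η : Config d M V) (x y : Box d M) (v : V) : Config d M V := fun z w =>
  if w = v ∧ z = x then η y v
  else if w = v ∧ z = y then η x v
  else η z w

/-- The generator of the exclusion dynamics: jumps between any two sites of the cube, at rate
`M^{-(d+2)}`, with exclusion among particles of the same velocity. -/
def genEx (f : Config d M V → ℝ) (η : Config d M V) : ℝ :=
  ((M : ℝ) ^ (d + 2))⁻¹ * ∑ v : V, ∑ x : Box d M, ∑ z : Box d M,
    occ η x v * (1 - occ η z v) * (f (exchange η x z v) - f η)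

/-- The collisions `(v, w, v', w')` that preserve momentum: `v + w = v' + w'`. -/
def collisions (V : Finset (Fin d → ℝ)) : Finset (V × V × V × V) :=
  univ.filter fun q => (q.1 : Fin d → ℝ) + q.2.1 = (q.2.2.1 : Fin d → ℝ) + q.2.2.2

/-- The rate of the collision `q = (v, w, v', w')` at `y`:
`η(y,v) η(y,w) [1 - η(y,v')] [1 - η(y,w')]`. -/
def collRate (y : Box d M) (q : V × V × V × V) (η : Config d M V) : ℝ :=
  occ η y q.1 * occ η y q.2.1 * (1 - occ η y q.2.2.1) * (1 - occ η y q.2.2.2)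

/-- `η^{y,q}`: for `q = (v₀, v₁, v₂, v₃)` the new value at `(y, v_j)` is the old value at
`(y, v_{j+2})`, with indices modulo `4`. Whenever `collRate y q η ≠ 0` the order of the cases is
irrelevant, since then `v₀, v₁` are occupied and `v₂, v₃` are empty at `y`. -/
def collide (η : Config d M V) (y : Box d M) (q : V × V × V × V) : Config d M V := fun z u =>
  if z = y then
    if u = q.1 then η y q.2.2.1
    else if u = q.2.1 then η y q.2.2.2
    else if u = q.2.2.1 then η y q.1
    else if u = q.2.2.2 then η y q.2.1
    else η z u
  else η z u

/-- The generator of the on-site collisions. -/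
def genColl (f : Config d M V → ℝ) (η : Config d M V) : ℝ :=
  ∑ y : Box d M, ∑ q ∈ collisions V, collRate y q η * (f (collide η y q) - f η)

/-- The generator of the stochastic lattice gas on the cube. -/
def gen (f : Config d M V → ℝ) (η : Config d M V) : ℝ := genEx f η + genColl f η

end LatticeGas

end

/-!
The variance is split along the numbers `n v` of particles of each velocity.

The group of velocity-wise permutations of the `N` sites acts on the configurations, and its orbits
are exactly the sets of configurations with given particle numbers. Let `h` be the average of `f`
over the orbits. The fluctuation `f - h` is controlled by the exchanges alone: a permutation is a
product of at most as many transpositions as it moves points, and averaging over its conjugates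
spreads these transpositions evenly over all pairs of sites, so the resulting constant does not
depend on `M` (`conjEnergy_le_of_support`, `card_mul_conjEnergy_le`, `sum_sq_sub_orbitAvg_le`).

The function `h` depends only on the particle numbers. In Model I the only collisions with an effect
are `(e_j, -e_j) → (±e_l, ∓e_l)`, which move one pair of particles from direction `j` to direction
`l`. The number of configurations with particle numbers `n` is the product of the binomial
coefficients `N.choose (n v)`. By log-concavity of these (`sliceCard_mul_le`), for two different
states one of the two can be moved by a collision towards the other without decreasing its weight
below the smaller of the two weights. Hence the superlevel sets of the weight are connected
(`reachable_superlevel`), and Cauchy-Schwarz along a self-avoiding path gives a Poincaré inequality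
(`sum_weighted_sq_sub_le`), with a loss of the square of the number of states, which is at most
`(N + 1) ^ (d - 1)` by the conservation laws. A possible collision is active at a fixed site with
conditional probability at least `N⁻⁴` (`sliceCard_le_mul_card_isActive`). This bounds the variance
of `h` by its collision Dirichlet form, which in turn is compared with that of `f` (`collForm_le`).
Reversibility (`sum_mul_neg_gen`) identifies the Dirichlet form of the generator.
-/

namespace LatticeGas

open Finset

noncomputable section

section General

variable {d M : ℕ} {V : Finset (Fin d → ℝ)}

/-! ### Particle numbers and the action of site permutations -/

/-- The number of particles of velocity `v`. -/
def cnt (η : Config d M V) (v : V) : ℕ := (univ.filter fun x => η x v = true).card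

/-- The right action of velocity-wise permutations of the sites on configurations. -/
def act (g : V → Equiv.Perm (Box d M)) (η : Config d M V) : Config d M V :=
  fun x v => η (g v x) v

lemma act_act (g h : V → Equiv.Perm (Box d M)) (η : Config d M V) :
    act g (act h η) = act (h * g) η := rfl

@[simp] lemma act_one (η : Config d M V) : act 1 η = η := rfl

@[simp] lemma act_inv_act (g : V → Equiv.Perm (Box d M)) (η : Config d M V) :
    act g⁻¹ (act g η) = η := by rw [act_act]; simp

@[simp] lemma act_act_inv (g : V → Equiv.Perm (Box d M)) (η : Config d M V) :
    act g (act g⁻¹ η) = η := by rw [act_act]; simp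

lemma cnt_act (g : V → Equiv.Perm (Box d M)) (η : Config d M V) : cnt (act g η) = cnt η := by
  funext v
  exact Finset.card_equiv (g v) fun x => by rw [mem_filter, mem_filter]; simp [act]

/-- The orbits of the action are the sets of configurations with given particle numbers. -/
lemma exists_act_of_cnt_eq {η ξ : Config d M V} (h : cnt η = cnt ξ) : ∃ g, act g η = ξ := by
  have key : ∀ v : V, ∃ σ : Equiv.Perm (Box d M), ∀ x, η (σ x) v = ξ x v := by
    intro v
    have hv : Fintype.card {x // ξ x v = true} = Fintype.card {x // η x v = true} := by
      rw [Fintype.card_subtype, Fintype.card_subtype]; exact (congrFun h v).symm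
    have e := Fintype.equivOfCardEq hv
    refine ⟨e.extendSubtype, fun x => ?_⟩
    by_cases hx : ξ x v = true
    · rw [hx]
      exact e.extendSubtype_mem x hx
    · rw [Bool.eq_false_of_not_eq_true hx]
      exact Bool.eq_false_of_not_eq_true (e.extendSubtype_not_mem x hx)
  choose σ hσ using key
  exact ⟨σ, funext fun x => funext fun v => hσ v x⟩

lemma exchange_eq_act (η : Config d M V) (x z : Box d M) (v : V) :
    exchange η x z v = act (Pi.mulSingle v (Equiv.swap x z)) η := by
  funext y w
  by_cases hw : w = v
  · subst hw
    simp only [exchange, act, Pi.mulSingle_eq_same, Equiv.swap_apply_def, true_and]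
    split_ifs <;> simp_all
  · simp [exchange, act, hw, Pi.mulSingle_eq_of_ne]

lemma sum_occ (η : Config d M V) (v : V) : ∑ x, occ η x v = cnt η v := by
  simp [occ, cnt, Finset.sum_boole]

/-- The conserved quantities depend on a configuration only through its particle numbers. -/
lemma avgI_eq_iff (η ξ : Config d M V) : avgI η = avgI ξ ↔
    ∑ v, cnt η v = ∑ v, cnt ξ v ∧
      ∀ k, ∑ v : V, (v : Fin d → ℝ) k * cnt η v = ∑ v : V, (v : Fin d → ℝ) k * cnt ξ v := by
  have hN : (Fintype.card (Box d M) : ℝ)⁻¹ ≠ 0 := by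
    have : Nonempty (Box d M) := ⟨fun _ => ⟨0, by simp⟩⟩
    exact inv_ne_zero (by exact_mod_cast Fintype.card_ne_zero)
  have h0 : ∀ η : Config d M V, (∑ x, siteI η x) 0 = ((∑ v, cnt η v : ℕ) : ℝ) := by
    intro η
    simp only [Finset.sum_apply, siteI, Fin.cons_zero]
    rw [Finset.sum_comm]
    simp [sum_occ]
  have h1 : ∀ (η : Config d M V) (k : Fin d), (∑ x, siteI η x) k.succ =
      ∑ v : V, (v : Fin d → ℝ) k * cnt η v := by
    intro η k
    simp only [Finset.sum_apply, siteI, Fin.cons_succ]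
    rw [Finset.sum_comm]
    simp [← Finset.mul_sum, sum_occ]
  rw [avgI, avgI, (smul_right_injective (Fin (d + 1) → ℝ) hN).eq_iff, funext_iff,
    Fin.forall_fin_succ, h0, h0, Nat.cast_inj]
  simp only [h1]

lemma mem_level {i : Fin (d + 1) → ℝ} {η : Config d M V} : η ∈ level d M V i ↔ avgI η = i := by
  simp [level]

lemma mem_level_iff_of_cnt_eq {η ξ : Config d M V} (h : cnt η = cnt ξ) (i : Fin (d + 1) → ℝ) :
    η ∈ level d M V i ↔ ξ ∈ level d M V i := by
  rw [mem_level, mem_level, (avgI_eq_iff η ξ).2 (by simp [h])]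

lemma act_mem_level (g : V → Equiv.Perm (Box d M)) {η : Config d M V} {i : Fin (d + 1) → ℝ} :
    act g η ∈ level d M V i ↔ η ∈ level d M V i :=
  mem_level_iff_of_cnt_eq (cnt_act g η) i

lemma sum_level_act (g : V → Equiv.Perm (Box d M)) (i : Fin (d + 1) → ℝ)
    (φ : Config d M V → ℝ) :
    ∑ η ∈ level d M V i, φ (act g η) = ∑ η ∈ level d M V i, φ η :=
  Finset.sum_nbij' (act g) (act g⁻¹) (fun _ h => (act_mem_level g).2 h)
    (fun _ h => (act_mem_level _).2 h) (by simp) (by simp) (by simp)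

/-! ### The gap of the exchange dynamics on an orbit -/

/-- The squared `ℓ²` norm, over the level set, of the increment of `f` along the action of `g`. -/
def energy (i : Fin (d + 1) → ℝ) (f : Config d M V → ℝ) (g : V → Equiv.Perm (Box d M)) : ℝ :=
  ∑ η ∈ level d M V i, (f (act g η) - f η) ^ 2

lemma energy_nonneg (i : Fin (d + 1) → ℝ) (f : Config d M V → ℝ)
    (g : V → Equiv.Perm (Box d M)) : 0 ≤ energy i f g := sum_nonneg fun _ _ => sq_nonneg _

@[simp] lemma energy_one (i : Fin (d + 1) → ℝ) (f : Config d M V → ℝ) : energy i f 1 = 0 := by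
  simp [energy]

/-- A form of Young's inequality for squares, used in place of the triangle inequality in `ℓ²`. -/
lemma add_sq_le_young (a b : ℝ) {s : ℝ} (hs : 0 < s) :
    (a + b) ^ 2 ≤ (1 + s) * a ^ 2 + (1 + s⁻¹) * b ^ 2 := by
  have h : (1 + s) * a ^ 2 + (1 + s⁻¹) * b ^ 2 - (a + b) ^ 2 = s * (a - s⁻¹ * b) ^ 2 := by
    field_simp; ring
  nlinarith [mul_nonneg hs.le (sq_nonneg (a - s⁻¹ * b))]

lemma energy_mul_le (i : Fin (d + 1) → ℝ) (f : Config d M V → ℝ)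
    (g h : V → Equiv.Perm (Box d M)) {s : ℝ} (hs : 0 < s) :
    energy i f (g * h) ≤ (1 + s) * energy i f g + (1 + s⁻¹) * energy i f h := by
  have hh : energy i f h =
      ∑ η ∈ level d M V i, (f (act h (act g η)) - f (act g η)) ^ 2 :=
    (sum_level_act g i fun η => (f (act h η) - f η) ^ 2).symm
  rw [hh, energy, energy, mul_sum, mul_sum, ← sum_add_distrib]
  refine sum_le_sum fun η _ => ?_
  have e : f (act (g * h) η) - f η =
      (f (act g η) - f η) + (f (act h (act g η)) - f (act g η)) := by rw [act_act]; ring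
  rw [e]
  exact add_sq_le_young _ _ hs

/-- The total energy of the conjugates of `g`. -/
def conjEnergy (i : Fin (d + 1) → ℝ) (f : Config d M V → ℝ) (g : V → Equiv.Perm (Box d M)) : ℝ :=
  ∑ σ : V → Equiv.Perm (Box d M), energy i f (σ * g * σ⁻¹)

lemma conjEnergy_mul_le (i : Fin (d + 1) → ℝ) (f : Config d M V → ℝ)
    (g h : V → Equiv.Perm (Box d M)) {s : ℝ} (hs : 0 < s) :
    conjEnergy i f (g * h) ≤ (1 + s) * conjEnergy i f g + (1 + s⁻¹) * conjEnergy i f h := by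
  rw [conjEnergy, conjEnergy, conjEnergy, mul_sum, mul_sum, ← sum_add_distrib]
  refine sum_le_sum fun σ _ => ?_
  have := energy_mul_le i f (σ * g * σ⁻¹) (σ * h * σ⁻¹) hs
  rwa [show σ * g * σ⁻¹ * (σ * h * σ⁻¹) = σ * (g * h) * σ⁻¹ by group] at this

/-- An element of the group that moves `k` (site, velocity) pairs is a product of at most `k`
transpositions, so by Cauchy-Schwarz its conjugates have energy at most `k ^ 2` times the bound
for one transposition. -/
lemma conjEnergy_le_of_support (i : Fin (d + 1) → ℝ) (f : Config d M V → ℝ) {B : ℝ}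
    (hB : ∀ (v : V) (x z : Box d M), x ≠ z →
      conjEnergy i f (Pi.mulSingle v (Equiv.swap x z)) ≤ B) (hB0 : 0 ≤ B) :
    ∀ (k : ℕ) (g : V → Equiv.Perm (Box d M)), ∑ v, (g v).support.card ≤ k →
      conjEnergy i f g ≤ (k : ℝ) ^ 2 * B := by
  have hone : conjEnergy i f 1 = 0 := by simp [conjEnergy]
  intro k
  induction k with
  | zero =>
    intro g hg
    have : g = 1 := by
      funext v
      have := Finset.sum_eq_zero_iff.1 (Nat.le_zero.1 hg) v (mem_univ v)
      simpa using this
    simp [this, hone]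
  | succ k ih =>
    intro g hg
    by_cases h1 : g = 1
    · rw [h1, hone]; positivity
    obtain ⟨v, hv⟩ := Function.ne_iff.1 h1
    obtain ⟨x, hx⟩ : ∃ x, g v x ≠ x := by
      by_contra! hcon
      exact hv (Equiv.ext hcon)
    set t : V → Equiv.Perm (Box d M) := Pi.mulSingle v (Equiv.swap x (g v x)) with ht
    have htt : t * (t * g) = g := by
      rw [← mul_assoc, ht, ← Pi.mulSingle_mul]; simp
    have hsupp : ∑ w, ((t * g) w).support.card < ∑ w, (g w).support.card := by
      refine sum_lt_sum (fun w _ => ?_) ⟨v, mem_univ v, ?_⟩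
      · by_cases hw : w = v
        · subst hw
          simpa [ht] using (Equiv.Perm.card_support_swap_mul hx).le
        · simp [ht, hw]
      · simpa [ht] using Equiv.Perm.card_support_swap_mul hx
    have hB' := hB v x (g v x) hx.symm
    have ih' := ih (t * g) (by omega)
    rcases Nat.eq_zero_or_pos k with rfl | hk
    · have htg : t * g = 1 := by
        funext w
        have := Finset.sum_eq_zero_iff.1 (Nat.lt_one_iff.1 (hsupp.trans_le hg)) w (mem_univ w)
        simpa using this
      have : g = t := by rw [← htt, htg, mul_one]
      rw [this]
      simpa using hB'
    · have hk' : (0 : ℝ) < k := by exact_mod_cast hk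
      have := conjEnergy_mul_le i f t (t * g) hk'
      rw [htt] at this
      calc conjEnergy i f g ≤ (1 + k) * B + (1 + (k : ℝ)⁻¹) * ((k : ℝ) ^ 2 * B) := by
            refine this.trans ?_
            gcongr
        _ = ((k + 1 : ℕ) : ℝ) ^ 2 * B := by
            push_cast; field_simp; ring

/-- The sum of the squared increments of `f` over all exchanges. Up to the factor
`M ^ (-(d + 2)) / 4` this is the unnormalised Dirichlet form of the exclusion dynamics. -/
def exForm (i : Fin (d + 1) → ℝ) (f : Config d M V → ℝ) : ℝ :=
  ∑ η ∈ level d M V i, ∑ v : V, ∑ x : Box d M, ∑ z : Box d M, (f (exchange η x z v) - f η) ^ 2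

lemma exForm_eq_sum_energy (i : Fin (d + 1) → ℝ) (f : Config d M V → ℝ) :
    exForm i f = ∑ v : V, ∑ x : Box d M, ∑ z : Box d M,
      energy i f (Pi.mulSingle v (Equiv.swap x z)) := by
  simp only [exForm, energy, exchange_eq_act]
  rw [sum_comm]
  refine sum_congr rfl fun v _ => ?_
  rw [sum_comm]
  refine sum_congr rfl fun x _ => ?_
  rw [sum_comm]

lemma exForm_nonneg (i : Fin (d + 1) → ℝ) (f : Config d M V → ℝ) : 0 ≤ exForm i f :=
  sum_nonneg fun _ _ => sum_nonneg fun _ _ => sum_nonneg fun _ _ => sum_nonneg fun _ _ =>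
    sq_nonneg _

lemma mulSingle_swap_conj (v : V) (x z : Box d M) (σ : V → Equiv.Perm (Box d M)) :
    σ * Pi.mulSingle v (Equiv.swap x z) * σ⁻¹ =
      Pi.mulSingle v (Equiv.swap (σ v x) (σ v z)) := by
  funext w
  by_cases hw : w = v
  · subst hw
    simp [Equiv.swap_apply_apply]
  · simp [hw]

lemma exists_perm_apply_pair {α : Type*} [DecidableEq α] {x z x' z' : α} (h : x ≠ z)
    (h' : x' ≠ z') : ∃ τ : Equiv.Perm α, τ x = x' ∧ τ z = z' := by
  refine ⟨Equiv.swap (Equiv.swap x x' z) z' * Equiv.swap x x', ?_, ?_⟩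
  · rw [Equiv.Perm.mul_apply, Equiv.swap_apply_left, Equiv.swap_apply_of_ne_of_ne _ h']
    intro hcon
    have := congrArg (Equiv.swap x x') hcon
    rw [Equiv.swap_apply_right, Equiv.swap_apply_self] at this
    exact h this
  · rw [Equiv.Perm.mul_apply, Equiv.swap_apply_left]

/-- The conjugates of a transposition equidistribute over the transpositions of the same
velocity. -/
lemma card_mul_conjEnergy_le (i : Fin (d + 1) → ℝ) (f : Config d M V → ℝ) (v : V)
    {x z : Box d M} (hxz : x ≠ z) :
    ((Fintype.card (Box d M) : ℝ) * (Fintype.card (Box d M) - 1)) *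
        conjEnergy i f (Pi.mulSingle v (Equiv.swap x z)) ≤
      Fintype.card (V → Equiv.Perm (Box d M)) * exForm i f := by
  set φ : Box d M → Box d M → ℝ := fun a b => energy i f (Pi.mulSingle v (Equiv.swap a b)) with hφ
  have hT : ∀ p : Box d M × Box d M, p.1 ≠ p.2 →
      ∑ σ : V → Equiv.Perm (Box d M), φ (σ v p.1) (σ v p.2) =
        ∑ σ : V → Equiv.Perm (Box d M), φ (σ v x) (σ v z) := by
    intro p hp
    obtain ⟨τ, h1, h2⟩ := exists_perm_apply_pair hxz hp
    rw [← Equiv.sum_comp (Equiv.mulRight (Pi.mulSingle v τ))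
      (fun σ : V → Equiv.Perm (Box d M) => φ (σ v x) (σ v z))]
    simp [h1, h2]
  have hconj : conjEnergy i f (Pi.mulSingle v (Equiv.swap x z)) =
      ∑ σ : V → Equiv.Perm (Box d M), φ (σ v x) (σ v z) := by
    simp only [conjEnergy, mulSingle_swap_conj, hφ]
  have hcard : (((univ : Finset (Box d M)).offDiag).card : ℝ) =
      (Fintype.card (Box d M) : ℝ) * (Fintype.card (Box d M) - 1) := by
    rw [offDiag_card, card_univ, Nat.cast_sub (Nat.le_mul_self _)]
    push_cast; ring
  have hsum : ∑ p ∈ (univ : Finset (Box d M)).offDiag,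
      ∑ σ : V → Equiv.Perm (Box d M), φ (σ v p.1) (σ v p.2) =
      ((univ : Finset (Box d M)).offDiag).card *
        conjEnergy i f (Pi.mulSingle v (Equiv.swap x z)) := by
    rw [hconj, ← nsmul_eq_mul, ← sum_const]
    exact sum_congr rfl fun p hp => hT p (mem_offDiag.1 hp).2.2
  rw [← hcard, ← hsum, sum_comm, ← nsmul_eq_mul, ← card_univ, ← sum_const]
  refine sum_le_sum fun σ _ => ?_
  calc ∑ p ∈ (univ : Finset (Box d M)).offDiag, φ (σ v p.1) (σ v p.2)
      ≤ ∑ p : Box d M × Box d M, φ (σ v p.1) (σ v p.2) :=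
        sum_le_sum_of_subset_of_nonneg (subset_univ _) fun _ _ _ => energy_nonneg _ _ _
    _ = ∑ a, ∑ b, φ a b := by
        rw [Fintype.sum_prod_type]
        exact (Equiv.sum_comp (σ v) fun a => ∑ b, φ a (σ v b)).trans
          (sum_congr rfl fun a _ => Equiv.sum_comp (σ v) (φ a))
    _ ≤ exForm i f := by
        rw [exForm_eq_sum_energy]
        exact single_le_sum (f := fun v => ∑ x : Box d M, ∑ z : Box d M,
          energy i f (Pi.mulSingle v (Equiv.swap x z)))
          (fun _ _ => sum_nonneg fun _ _ => sum_nonneg fun _ _ => energy_nonneg _ _ _)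
          (mem_univ v)

/-- The average of `f` over the orbits of the velocity-wise permutations of the sites. -/
def orbitAvg (f : Config d M V → ℝ) (η : Config d M V) : ℝ :=
  (Fintype.card (V → Equiv.Perm (Box d M)) : ℝ)⁻¹ *
    ∑ g : V → Equiv.Perm (Box d M), f (act g η)

lemma orbitAvg_act (f : Config d M V → ℝ) (h : V → Equiv.Perm (Box d M)) (η : Config d M V) :
    orbitAvg f (act h η) = orbitAvg f η := by
  rw [orbitAvg, orbitAvg]
  congr 1
  exact Equiv.sum_comp (Equiv.mulLeft h) fun g => f (act g η)

lemma exists_orbitAvg_eq_comp_cnt (f : Config d M V → ℝ) :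
    ∃ F : (V → ℕ) → ℝ, ∀ η, orbitAvg f η = F (cnt η) := by
  have : Function.FactorsThrough (orbitAvg f) (cnt : Config d M V → V → ℕ) := by
    intro η ξ h
    obtain ⟨g, rfl⟩ := exists_act_of_cnt_eq h
    exact (orbitAvg_act f g η).symm
  obtain ⟨F, hF⟩ := (Function.factorsThrough_iff _).1 this
  exact ⟨F, fun η => congrFun hF η⟩

lemma sum_sq_sub_orbitAvg_le_avg_energy (i : Fin (d + 1) → ℝ) (f : Config d M V → ℝ) :
    ∑ η ∈ level d M V i, (f η - orbitAvg f η) ^ 2 ≤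
      (Fintype.card (V → Equiv.Perm (Box d M)) : ℝ)⁻¹ *
        ∑ g : V → Equiv.Perm (Box d M), energy i f g := by
  have hG : (0 : ℝ) < Fintype.card (V → Equiv.Perm (Box d M)) := by
    exact_mod_cast Fintype.card_pos
  simp only [energy]
  rw [sum_comm, mul_sum]
  refine sum_le_sum fun η _ => ?_
  have h1 : f η - orbitAvg f η = (Fintype.card (V → Equiv.Perm (Box d M)) : ℝ)⁻¹ *
      ∑ g : V → Equiv.Perm (Box d M), (f η - f (act g η)) := by
    rw [orbitAvg, sum_sub_distrib, sum_const, card_univ, nsmul_eq_mul]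
    field_simp
  have h2 := sq_sum_le_card_mul_sum_sq (s := (univ : Finset (V → Equiv.Perm (Box d M))))
    (f := fun g => f η - f (act g η))
  rw [card_univ] at h2
  rw [h1, mul_pow]
  calc _ ≤ ((Fintype.card (V → Equiv.Perm (Box d M)) : ℝ)⁻¹) ^ 2 *
        (Fintype.card (V → Equiv.Perm (Box d M)) *
          ∑ g : V → Equiv.Perm (Box d M), (f η - f (act g η)) ^ 2) := by gcongr
    _ = _ := by
        simp only [← sub_sq_comm (f η)]
        field_simp

/-- The spectral gap of the exchange dynamics on each orbit: the transpositions of a random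
element of the group are, after averaging over conjugates, spread evenly over all pairs of
sites, so that the constant does not depend on the size of the cube. -/
lemma sum_sq_sub_orbitAvg_le (hN : 2 ≤ Fintype.card (Box d M)) (i : Fin (d + 1) → ℝ)
    (f : Config d M V → ℝ) :
    ∑ η ∈ level d M V i, (f η - orbitAvg f η) ^ 2 ≤ 2 * (V.card : ℝ) ^ 2 * exForm i f := by
  set N : ℝ := ((Fintype.card (Box d M) : ℕ) : ℝ) with hNdef
  have hN' : (2 : ℝ) ≤ N := by rw [hNdef]; exact_mod_cast hN
  set G : ℝ := ((Fintype.card (V → Equiv.Perm (Box d M)) : ℕ) : ℝ) with hGdef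
  have hG : 0 < G := by rw [hGdef]; exact_mod_cast Fintype.card_pos
  have hNN : 0 < N * (N - 1) := by nlinarith
  set B : ℝ := G * exForm i f / (N * (N - 1)) with hBdef
  have hB0 : 0 ≤ B := by
    have := exForm_nonneg i f
    positivity
  have hB : ∀ (v : V) (x z : Box d M), x ≠ z →
      conjEnergy i f (Pi.mulSingle v (Equiv.swap x z)) ≤ B := by
    intro v x z hxz
    rw [hBdef, le_div_iff₀ hNN, mul_comm]
    exact card_mul_conjEnergy_le i f v hxz
  have hsupp : ∀ g : V → Equiv.Perm (Box d M), ∑ v, (g v).support.card ≤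
      V.card * Fintype.card (Box d M) := by
    intro g
    calc ∑ v, (g v).support.card ≤ ∑ _v : V, Fintype.card (Box d M) :=
          sum_le_sum fun v _ => card_le_univ _
      _ = _ := by simp
  have hcomm : G * ∑ g : V → Equiv.Perm (Box d M), energy i f g =
      ∑ g : V → Equiv.Perm (Box d M), conjEnergy i f g := by
    simp only [conjEnergy]
    rw [sum_comm, hGdef, ← card_univ, ← nsmul_eq_mul, ← sum_const]
    exact sum_congr rfl fun σ _ => (Equiv.sum_comp (MulAut.conj σ).toEquiv (energy i f)).symm
  have hle : ∑ g : V → Equiv.Perm (Box d M), conjEnergy i f g ≤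
      G * ((V.card * N) ^ 2 * B) := by
    rw [hGdef, ← card_univ, ← nsmul_eq_mul, ← sum_const]
    refine sum_le_sum fun g _ => ?_
    have := conjEnergy_le_of_support i f hB hB0 _ g (hsupp g)
    rwa [Nat.cast_mul] at this
  have h3 : ∑ g : V → Equiv.Perm (Box d M), energy i f g ≤ (V.card * N) ^ 2 * B := by
    rw [← hcomm] at hle
    exact le_of_mul_le_mul_left hle hG
  calc _ ≤ G⁻¹ * ∑ g : V → Equiv.Perm (Box d M), energy i f g :=
        sum_sq_sub_orbitAvg_le_avg_energy i f
    _ ≤ G⁻¹ * ((V.card * N) ^ 2 * B) := by gcongr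
    _ = (V.card : ℝ) ^ 2 * exForm i f * (N / (N - 1)) := by
        have : N - 1 ≠ 0 := by linarith
        rw [hBdef]; field_simp
    _ ≤ (V.card : ℝ) ^ 2 * exForm i f * 2 := by
        have := exForm_nonneg i f
        gcongr
        rw [div_le_iff₀ (by linarith)]; linarith
    _ = _ := by ring

/-! ### Collisions -/

/-- The collision `q` can take place at `y`: its incoming velocities are occupied and its outgoing
velocities are empty. -/
def IsActive (y : Box d M) (q : V × V × V × V) (η : Config d M V) : Prop :=
  η y q.1 = true ∧ η y q.2.1 = true ∧ η y q.2.2.1 = false ∧ η y q.2.2.2 = false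

instance (y : Box d M) (q : V × V × V × V) : DecidablePred (IsActive (M := M) y q) :=
  fun _ => by unfold IsActive; infer_instance

lemma collRate_eq (y : Box d M) (q : V × V × V × V) (η : Config d M V) :
    collRate y q η = if IsActive y q η then 1 else 0 := by
  unfold collRate occ IsActive
  by_cases h0 : η y q.1 = true <;> by_cases h1 : η y q.2.1 = true <;>
    by_cases h2 : η y q.2.2.1 = true <;> by_cases h3 : η y q.2.2.2 = true <;>
    simp [h0, h1, h2, h3]

/-- The collision with incoming and outgoing velocities interchanged. -/
def revColl (q : V × V × V × V) : V × V × V × V := (q.2.2.1, q.2.2.2, q.1, q.2.1)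

lemma revColl_mem {q : V × V × V × V} : revColl q ∈ collisions V ↔ q ∈ collisions V := by
  simp [collisions, revColl, eq_comm]

section Generic

variable {y : Box d M} {q : V × V × V × V} {η : Config d M V}

lemma collide_of_ne {z : Box d M} (hz : z ≠ y) (u : V) : collide η y q z u = η z u := by
  simp [collide, hz]

lemma IsActive.collide_self (h : IsActive y q η) (u : V) : collide η y q y u =
    if u = q.1 ∨ u = q.2.1 then false else if u = q.2.2.1 ∨ u = q.2.2.2 then true else η y u := by
  obtain ⟨h0, h1, h2, h3⟩ := h
  unfold collide
  split_ifs <;> simp_all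

lemma IsActive.ne (h : IsActive y q η) :
    q.1 ≠ q.2.2.1 ∧ q.1 ≠ q.2.2.2 ∧ q.2.1 ≠ q.2.2.1 ∧ q.2.1 ≠ q.2.2.2 := by
  obtain ⟨h0, h1, h2, h3⟩ := h
  refine ⟨?_, ?_, ?_, ?_⟩ <;> intro h <;> simp_all

lemma IsActive.collide (h : IsActive y q η) : IsActive y (revColl q) (collide η y q) := by
  obtain ⟨n1, n2, n3, n4⟩ := h.ne
  refine ⟨?_, ?_, ?_, ?_⟩ <;> rw [h.collide_self] <;>
    simp [revColl, n1.symm, n2.symm, n3.symm, n4.symm]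

lemma IsActive.collide_collide (h : IsActive y q η) :
    LatticeGas.collide (LatticeGas.collide η y q) y (revColl q) = η := by
  funext z u
  by_cases hz : z = y
  · subst hz
    rw [h.collide.collide_self, h.collide_self]
    obtain ⟨n1, n2, n3, n4⟩ := h.ne
    obtain ⟨h0, h1, h2, h3⟩ := h
    simp only [revColl]
    rcases eq_or_ne u q.1 with rfl | e0
    · simp [h0, n1, n2]
    rcases eq_or_ne u q.2.1 with rfl | e1
    · simp [h1, n3, n4]
    rcases eq_or_ne u q.2.2.1 with rfl | e2
    · simp [h2]
    rcases eq_or_ne u q.2.2.2 with rfl | e3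
    · simp [h3]
    simp [e0, e1, e2, e3]
  · rw [collide_of_ne hz, collide_of_ne hz]

lemma IsActive.occ_collide (h : IsActive y q η) (h01 : q.1 ≠ q.2.1) (h23 : q.2.2.1 ≠ q.2.2.2)
    (u : V) : occ (LatticeGas.collide η y q) y u = occ η y u +
      ((if u = q.2.2.1 then 1 else 0) + (if u = q.2.2.2 then 1 else 0)
        - (if u = q.1 then 1 else 0) - (if u = q.2.1 then 1 else 0)) := by
  obtain ⟨n1, n2, n3, n4⟩ := h.ne
  rw [occ, h.collide_self]
  obtain ⟨h0, h1, h2, h3⟩ := h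
  rcases eq_or_ne u q.1 with rfl | e0
  · simp [occ, h0, h01, n1, n2]
  rcases eq_or_ne u q.2.1 with rfl | e1
  · simp [occ, h1, h01.symm, n3, n4]
  rcases eq_or_ne u q.2.2.1 with rfl | e2
  · simp [occ, h2, n1.symm, n3.symm, h23]
  rcases eq_or_ne u q.2.2.2 with rfl | e3
  · simp [occ, h3, n2.symm, n4.symm, h23.symm]
  simp [occ, e0, e1, e2, e3]

lemma IsActive.cnt_collide (h : IsActive y q η) (h01 : q.1 ≠ q.2.1) (h23 : q.2.2.1 ≠ q.2.2.2)
    (u : V) : (cnt (LatticeGas.collide η y q) u : ℝ) = cnt η u +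
      ((if u = q.2.2.1 then 1 else 0) + (if u = q.2.2.2 then 1 else 0)
        - (if u = q.1 then 1 else 0) - (if u = q.2.1 then 1 else 0)) := by
  rw [← sum_occ, ← sum_occ, ← add_sum_erase _ _ (mem_univ y), ← add_sum_erase _ _ (mem_univ y),
    h.occ_collide h01 h23]
  have : ∑ x ∈ univ.erase y, occ (LatticeGas.collide η y q) x u = ∑ x ∈ univ.erase y, occ η x u :=
    sum_congr rfl fun x hx => by simp [occ, collide_of_ne (ne_of_mem_erase hx)]
  rw [this]; ring

lemma IsActive.collide_mem_level (h : IsActive y q η) (h01 : q.1 ≠ q.2.1)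
    (h23 : q.2.2.1 ≠ q.2.2.2) (hq : q ∈ collisions V) {i : Fin (d + 1) → ℝ}
    (hη : η ∈ level d M V i) : LatticeGas.collide η y q ∈ level d M V i := by
  have key : ∀ c : V → ℝ, ∑ u, c u * cnt (LatticeGas.collide η y q) u = ∑ u, c u * cnt η u +
      (c q.2.2.1 + c q.2.2.2 - c q.1 - c q.2.1) := by
    intro c
    simp only [h.cnt_collide h01 h23, mul_add, mul_sub, sum_add_distrib, sum_sub_distrib, mul_ite,
      mul_one, mul_zero, sum_ite_eq', mem_univ, if_true]
  rw [mem_level] at hη ⊢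
  rw [← hη, avgI_eq_iff]
  refine ⟨?_, fun k => ?_⟩
  · have := key fun _ => 1
    simp only [one_mul] at this
    have h' : ∑ u, (cnt (LatticeGas.collide η y q) u : ℝ) = ∑ u, (cnt η u : ℝ) := by
      rw [this]; ring
    exact_mod_cast h'
  · rw [key fun v => (v : Fin d → ℝ) k]
    have hk := congrFun (mem_filter.1 hq).2 k
    simp only [Pi.add_apply] at hk
    linarith

end Generic

/-- Reversibility of the collision `q`, provided that collisions with two equal incoming or
outgoing velocities have rate zero. -/
lemma sum_collRate_eq_of_generic (y : Box d M) {q : V × V × V × V} (hq : q ∈ collisions V)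
    (hgen : ∀ η : Config d M V, IsActive y q η ∨ IsActive y (revColl q) η →
      q.1 ≠ q.2.1 ∧ q.2.2.1 ≠ q.2.2.2)
    (i : Fin (d + 1) → ℝ) (ψ : Config d M V → Config d M V → ℝ) :
    ∑ η ∈ level d M V i, collRate y q η * ψ η (collide η y q) =
      ∑ η ∈ level d M V i, collRate y (revColl q) η * ψ (collide η y (revColl q)) η := by
  simp only [collRate_eq, ite_mul, one_mul, zero_mul, ← sum_filter]
  refine sum_nbij' (fun η => collide η y q) (fun η => collide η y (revColl q)) ?_ ?_ ?_ ?_ ?_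
  · intro η hη
    obtain ⟨h1, h2⟩ := mem_filter.1 hη
    obtain ⟨h01, h23⟩ := hgen η (Or.inl h2)
    exact mem_filter.2 ⟨h2.collide_mem_level h01 h23 hq h1, h2.collide⟩
  · intro η hη
    obtain ⟨h1, h2⟩ := mem_filter.1 hη
    obtain ⟨h01, h23⟩ := hgen η (Or.inr h2)
    exact mem_filter.2 ⟨h2.collide_mem_level h23 h01 (revColl_mem.2 hq) h1, h2.collide⟩
  · intro η hη
    exact (mem_filter.1 hη).2.collide_collide
  · intro η hη
    exact (mem_filter.1 hη).2.collide_collide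
  · intro η hη
    rw [(mem_filter.1 hη).2.collide_collide]

/-! ### The velocities of Model I -/

/-- The velocity `e_j`. -/
def pos (j : Fin d) : ↥(modelI d) := ⟨Pi.single j 1, by simp [modelI]⟩

/-- The velocity `-e_j`. -/
def neg (j : Fin d) : ↥(modelI d) := ⟨-Pi.single j 1, by simp [modelI]⟩

lemma eq_pos_or_neg (v : ↥(modelI d)) : ∃ j, v = pos j ∨ v = neg j := by
  obtain ⟨v, hv⟩ := v
  simp only [modelI, mem_union, mem_image, mem_univ, true_and] at hv
  rcases hv with ⟨j, rfl⟩ | ⟨j, rfl⟩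
  · exact ⟨j, Or.inl rfl⟩
  · exact ⟨j, Or.inr rfl⟩

lemma pos_apply (j k : Fin d) : (pos j : Fin d → ℝ) k = if k = j then 1 else 0 := by
  simp [pos, Pi.single_apply]

lemma neg_apply (j k : Fin d) : (neg j : Fin d → ℝ) k = if k = j then -1 else 0 := by
  simp only [neg, Pi.neg_apply, Pi.single_apply]
  split_ifs <;> simp

lemma pos_injective : Function.Injective (pos : Fin d → ↥(modelI d)) := by
  intro j k h
  have := congrFun (congrArg Subtype.val h) j
  rw [pos_apply, pos_apply] at this
  by_contra hne
  simp [hne] at this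

lemma neg_injective : Function.Injective (neg : Fin d → ↥(modelI d)) := by
  intro j k h
  have := congrFun (congrArg Subtype.val h) j
  rw [neg_apply, neg_apply] at this
  by_contra hne
  simp [hne] at this

@[simp] lemma pos_inj {j k : Fin d} : pos j = pos k ↔ j = k := pos_injective.eq_iff

@[simp] lemma neg_inj {j k : Fin d} : neg j = neg k ↔ j = k := neg_injective.eq_iff

@[simp] lemma pos_ne_neg (j k : Fin d) : pos j ≠ neg k := by
  intro h
  have := congrFun (congrArg Subtype.val h) j
  rw [pos_apply, neg_apply, if_pos rfl] at this
  split_ifs at this <;> norm_num at this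

@[simp] lemma neg_ne_pos (j k : Fin d) : neg j ≠ pos k := (pos_ne_neg k j).symm

lemma sum_modelI {α : Type*} [AddCommMonoid α] (φ : ↥(modelI d) → α) :
    ∑ v, φ v = ∑ j, φ (pos j) + ∑ j, φ (neg j) := by
  have hb : Function.Bijective (Sum.elim pos neg : Fin d ⊕ Fin d → ↥(modelI d)) := by
    constructor
    · exact pos_injective.sumElim neg_injective pos_ne_neg
    · intro v
      obtain ⟨j, rfl | rfl⟩ := eq_pos_or_neg v
      · exact ⟨Sum.inl j, rfl⟩
      · exact ⟨Sum.inr j, rfl⟩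
  rw [← (Equiv.ofBijective _ hb).sum_comp, Fintype.sum_sum_type]
  rfl

lemma card_modelI (d : ℕ) : (modelI d).card = 2 * d := by
  have := sum_modelI (d := d) fun _ => 1
  simp at this
  omega

lemma eq_of_add_self_eq_add {v a b : ↥(modelI d)}
    (h : (v : Fin d → ℝ) + v = (a : Fin d → ℝ) + b) : a = v := by
  obtain ⟨j, rfl | rfl⟩ := eq_pos_or_neg v <;> obtain ⟨k, rfl | rfl⟩ := eq_pos_or_neg a <;>
    obtain ⟨l, rfl | rfl⟩ := eq_pos_or_neg b <;>
    have hj := congrFun h j <;>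
    simp only [Pi.add_apply, pos_apply, neg_apply] at hj <;>
    simp only [if_true] at hj <;> split_ifs at hj with hk hl hl <;>
    first
    | exact congrArg _ hk.symm
    | norm_num at hj

/-- In Model I a collision with two equal incoming, or two equal outgoing, velocities changes
nothing, and its rate vanishes. -/
lemma generic_of_isActive {y : Box d M}
    {q : ↥(modelI d) × ↥(modelI d) × ↥(modelI d) × ↥(modelI d)} (hq : q ∈ collisions (modelI d))
    {η : Config d M (modelI d)} (h : IsActive y q η ∨ IsActive y (revColl q) η) :
    q.1 ≠ q.2.1 ∧ q.2.2.1 ≠ q.2.2.2 := by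
  have hq' := (mem_filter.1 hq).2
  have hne : q.1 ≠ q.2.2.1 := by
    rcases h with h | h
    · exact h.ne.1
    · exact h.ne.1.symm
  constructor
  · intro h01
    rw [← h01] at hq'
    exact hne (eq_of_add_self_eq_add hq').symm
  · intro h23
    rw [← h23] at hq'
    exact hne (eq_of_add_self_eq_add hq'.symm)

lemma sum_collRate_eq (y : Box d M) {q : ↥(modelI d) × ↥(modelI d) × ↥(modelI d) × ↥(modelI d)}
    (hq : q ∈ collisions (modelI d)) (i : Fin (d + 1) → ℝ)
    (ψ : Config d M (modelI d) → Config d M (modelI d) → ℝ) :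
    ∑ η ∈ level d M (modelI d) i, collRate y q η * ψ η (collide η y q) =
      ∑ η ∈ level d M (modelI d) i,
        collRate y (revColl q) η * ψ (collide η y (revColl q)) η :=
  sum_collRate_eq_of_generic y hq (fun _ h => generic_of_isActive hq h) i ψ

lemma collRate_nonneg (y : Box d M) (q : V × V × V × V) (η : Config d M V) :
    0 ≤ collRate y q η := by
  rw [collRate_eq]; split_ifs <;> norm_num

lemma collRate_le_one (y : Box d M) (q : V × V × V × V) (η : Config d M V) :
    collRate y q η ≤ 1 := by
  rw [collRate_eq]; split_ifs <;> norm_num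

/-! ### The Dirichlet form -/

/-- Twice the unnormalised Dirichlet form of the collisions at the site `y`. -/
def collForm (i : Fin (d + 1) → ℝ) (y : Box d M) (f : Config d M V → ℝ) : ℝ :=
  ∑ q ∈ collisions V, ∑ η ∈ level d M V i, collRate y q η * (f (collide η y q) - f η) ^ 2

lemma collForm_nonneg (i : Fin (d + 1) → ℝ) (y : Box d M) (f : Config d M V → ℝ) :
    0 ≤ collForm i y f :=
  sum_nonneg fun _ _ => sum_nonneg fun _ _ => mul_nonneg (collRate_nonneg _ _ _) (sq_nonneg _)

lemma sum_revColl (φ : V × V × V × V → ℝ) :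
    ∑ q ∈ collisions V, φ (revColl q) = ∑ q ∈ collisions V, φ q :=
  sum_nbij' revColl revColl (fun _ h => revColl_mem.2 h) (fun _ h => revColl_mem.2 h)
    (fun _ _ => rfl) (fun _ _ => rfl) (fun _ _ => rfl)

lemma sum_mul_collisions_eq (i : Fin (d + 1) → ℝ) (y : Box d M)
    (f : Config d M (modelI d) → ℝ) :
    ∑ q ∈ collisions (modelI d), ∑ η ∈ level d M (modelI d) i,
      collRate y q η * (f η * (f η - f (collide η y q))) = collForm i y f / 2 := by
  set A := ∑ q ∈ collisions (modelI d), ∑ η ∈ level d M (modelI d) i,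
      collRate y q η * (f η * (f η - f (collide η y q))) with hA
  have h1 : A = ∑ q ∈ collisions (modelI d), ∑ η ∈ level d M (modelI d) i,
      collRate y q η * (f (collide η y q) * (f (collide η y q) - f η)) := by
    rw [hA, ← sum_revColl fun q => ∑ η ∈ level d M (modelI d) i,
      collRate y q η * (f (collide η y q) * (f (collide η y q) - f η))]
    exact sum_congr rfl fun q hq => sum_collRate_eq y hq i fun η ξ => f η * (f η - f ξ)
  have h2 : A + A = collForm i y f := by
    nth_rw 2 [h1]
    rw [hA, collForm, ← sum_add_distrib]
    refine sum_congr rfl fun q _ => ?_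
    rw [← sum_add_distrib]
    exact sum_congr rfl fun η _ => by ring
  linarith

lemma occ_eq (η : Config d M V) (x : Box d M) (v : V) : occ η x v = 0 ∨ occ η x v = 1 := by
  unfold occ; split_ifs <;> simp

lemma exchange_comm (η : Config d M V) (x z : Box d M) (v : V) :
    exchange η x z v = exchange η z x v := by
  rw [exchange_eq_act, exchange_eq_act, Equiv.swap_comm]

lemma exchange_exchange (η : Config d M V) (x z : Box d M) (v : V) :
    exchange (exchange η x z v) x z v = η := by
  rw [exchange_eq_act, exchange_eq_act, act_act, ← Pi.mulSingle_mul]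
  simp

lemma occ_exchange_left (η : Config d M V) (x z : Box d M) (v : V) :
    occ (exchange η x z v) x v = occ η z v := by
  simp [occ, exchange]

lemma occ_exchange_right (η : Config d M V) (x z : Box d M) (v : V) :
    occ (exchange η x z v) z v = occ η x v := by
  rw [exchange_comm, occ_exchange_left]

lemma exchange_eq_self {η : Config d M V} {x z : Box d M} {v : V} (h : occ η x v = occ η z v) :
    exchange η x z v = η := by
  have h' : η x v = η z v := by
    revert h
    unfold occ
    cases η x v <;> cases η z v <;> simp
  funext y w
  unfold exchange
  split_ifs with h1 h2
  · rw [h1.1, h1.2, h']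
  · rw [h2.1, h2.2, h']
  · rfl

/-- Reversibility of the exchange of `x` and `z`: exchanges between two occupied or two empty
sites change nothing, so that the exclusion rule can be dropped from the Dirichlet form. -/
lemma sum_mul_exchange_eq (i : Fin (d + 1) → ℝ) (f : Config d M V → ℝ) (v : V)
    (x z : Box d M) :
    ∑ η ∈ level d M V i, occ η x v * (1 - occ η z v) * (f η * (f η - f (exchange η x z v))) +
      ∑ η ∈ level d M V i, occ η z v * (1 - occ η x v) * (f η * (f η - f (exchange η z x v))) =
    (∑ η ∈ level d M V i, (f (exchange η x z v) - f η) ^ 2) / 2 := by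
  have hswap : ∀ φ : Config d M V → ℝ, ∑ η ∈ level d M V i, φ (exchange η x z v) =
      ∑ η ∈ level d M V i, φ η := by
    intro φ
    simp only [exchange_eq_act]
    exact sum_level_act _ i φ
  have h1 := hswap fun η => occ η x v * (1 - occ η z v) * (f η * (f η - f (exchange η x z v)))
  have h2 := hswap fun η => occ η z v * (1 - occ η x v) * (f η * (f η - f (exchange η z x v)))
  simp only [exchange_comm _ z x, exchange_exchange, occ_exchange_left, occ_exchange_right]
    at h1 h2 ⊢
  have h3 : (∑ η ∈ level d M V i, occ η x v * (1 - occ η z v) *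
        (f η * (f η - f (exchange η x z v))) +
      ∑ η ∈ level d M V i, occ η z v * (1 - occ η x v) *
        (f η * (f η - f (exchange η x z v)))) +
      (∑ η ∈ level d M V i, occ η z v * (1 - occ η x v) *
        (f (exchange η x z v) * (f (exchange η x z v) - f η)) +
      ∑ η ∈ level d M V i, occ η x v * (1 - occ η z v) *
        (f (exchange η x z v) * (f (exchange η x z v) - f η))) =
      ∑ η ∈ level d M V i, (f (exchange η x z v) - f η) ^ 2 := by
    rw [← sum_add_distrib, ← sum_add_distrib, ← sum_add_distrib]
    refine sum_congr rfl fun η _ => ?_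
    by_cases he : occ η x v = occ η z v
    · rw [exchange_eq_self he]; ring
    · rcases occ_eq η x v with hx | hx <;> rcases occ_eq η z v with hz | hz
      · exact absurd (hx.trans hz.symm) he
      · rw [hx, hz]; ring
      · rw [hx, hz]; ring
      · exact absurd (hx.trans hz.symm) he
  linarith

/-- The unnormalised Dirichlet form of the dynamics, by reversibility. -/
lemma sum_mul_neg_gen (i : Fin (d + 1) → ℝ) (f : Config d M (modelI d) → ℝ) :
    ∑ η ∈ level d M (modelI d) i, f η * -gen f η =
      ((M : ℝ) ^ (d + 2))⁻¹ * (exForm i f / 4) + (∑ y, collForm i y f) / 2 := by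
  have hex : ∑ η ∈ level d M (modelI d) i, f η * -genEx f η =
      ((M : ℝ) ^ (d + 2))⁻¹ * (exForm i f / 4) := by
    set E : ↥(modelI d) → Box d M → Box d M → ℝ := fun v x z => ∑ η ∈ level d M (modelI d) i,
      occ η x v * (1 - occ η z v) * (f η * (f η - f (exchange η x z v))) with hE
    have h1 : ∑ η ∈ level d M (modelI d) i, f η * -genEx f η =
        ((M : ℝ) ^ (d + 2))⁻¹ * ∑ v, ∑ x, ∑ z, E v x z := by
      have : ∑ v, ∑ x, ∑ z, E v x z = ∑ η ∈ level d M (modelI d) i, ∑ v, ∑ x, ∑ z,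
          occ η x v * (1 - occ η z v) * (f η * (f η - f (exchange η x z v))) := by
        symm
        rw [sum_comm]
        refine sum_congr rfl fun v _ => ?_
        rw [sum_comm]
        refine sum_congr rfl fun x _ => ?_
        rw [sum_comm]
      rw [this, mul_sum]
      refine sum_congr rfl fun η _ => ?_
      rw [genEx, ← mul_neg, mul_left_comm, ← sum_neg_distrib, mul_sum]
      congr 1
      refine sum_congr rfl fun v _ => ?_
      rw [← sum_neg_distrib, mul_sum]
      refine sum_congr rfl fun x _ => ?_
      rw [← sum_neg_distrib, mul_sum]
      exact sum_congr rfl fun z _ => by ring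
    have h2 : ∑ v, ∑ x, ∑ z, E v x z + ∑ v, ∑ x, ∑ z, E v x z = exForm i f / 2 := by
      have hc : ∑ v, ∑ x, ∑ z, E v x z = ∑ v, ∑ x, ∑ z, E v z x :=
        sum_congr rfl fun v _ => sum_comm
      rw [exForm_eq_sum_energy]
      nth_rw 2 [hc]
      rw [← sum_add_distrib, sum_div]
      refine sum_congr rfl fun v _ => ?_
      rw [← sum_add_distrib, sum_div]
      refine sum_congr rfl fun x _ => ?_
      rw [← sum_add_distrib, sum_div]
      refine sum_congr rfl fun z _ => ?_
      rw [hE, sum_mul_exchange_eq, energy]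
      simp only [exchange_eq_act]
    rw [h1]
    congr 1
    linarith
  have hcoll : ∑ η ∈ level d M (modelI d) i, f η * -genColl f η =
      (∑ y, collForm i y f) / 2 := by
    simp only [genColl, ← sum_neg_distrib, mul_sum]
    rw [sum_comm, sum_div]
    refine sum_congr rfl fun y _ => ?_
    rw [sum_comm, ← sum_mul_collisions_eq]
    refine sum_congr rfl fun q _ => sum_congr rfl fun η _ => ?_
    ring
  have hadd : ∀ η, f η * -gen f η = f η * -genEx f η + f η * -genColl f η := fun η => by
    rw [gen]; ring
  simp only [hadd, sum_add_distrib, hex, hcoll]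

/-- Replacing `f` by `h` costs at most the squared distance of `f` and `h`, because the rates are
bounded and the collisions preserve the uniform measure. -/
lemma collForm_le (i : Fin (d + 1) → ℝ) (y : Box d M) (f h : Config d M (modelI d) → ℝ) :
    collForm i y h ≤ 3 * collForm i y f +
      6 * (collisions (modelI d)).card * ∑ η ∈ level d M (modelI d) i, (f η - h η) ^ 2 := by
  set U := ∑ η ∈ level d M (modelI d) i, (f η - h η) ^ 2 with hU
  have hle : ∀ q, ∑ η ∈ level d M (modelI d) i, collRate y q η * (f η - h η) ^ 2 ≤ U := fun q =>
    sum_le_sum fun η _ => mul_le_of_le_one_left (sq_nonneg _) (collRate_le_one _ _ _)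
  have hle' : ∀ q ∈ collisions (modelI d), ∑ η ∈ level d M (modelI d) i,
      collRate y q η * (f (collide η y q) - h (collide η y q)) ^ 2 ≤ U := by
    intro q hq
    rw [sum_collRate_eq y hq i fun _ ξ => (f ξ - h ξ) ^ 2]
    exact hle _
  have hq : ∀ q ∈ collisions (modelI d), ∑ η ∈ level d M (modelI d) i,
      collRate y q η * (h (collide η y q) - h η) ^ 2 ≤
      3 * ∑ η ∈ level d M (modelI d) i, collRate y q η * (f (collide η y q) - f η) ^ 2 +
        6 * U := by
    intro q hq
    calc _ ≤ ∑ η ∈ level d M (modelI d) i,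
          (3 * (collRate y q η * (f (collide η y q) - f η) ^ 2) +
            3 * (collRate y q η * (f (collide η y q) - h (collide η y q)) ^ 2) +
            3 * (collRate y q η * (f η - h η) ^ 2)) := by
          refine sum_le_sum fun η _ => ?_
          have h0 := collRate_nonneg y q η
          set a := f (collide η y q) - f η
          set b := f (collide η y q) - h (collide η y q)
          set c := f η - h η
          have e : h (collide η y q) - h η = a - b + c := by ring
          rw [e, ← mul_assoc, ← mul_assoc, ← mul_assoc, mul_comm 3, mul_assoc, mul_assoc,
            mul_assoc, ← mul_add, ← mul_add]
          refine mul_le_mul_of_nonneg_left ?_ h0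
          nlinarith [sq_nonneg (a + b), sq_nonneg (a - c), sq_nonneg (b + c)]
      _ ≤ _ := by
          rw [sum_add_distrib, sum_add_distrib, ← mul_sum, ← mul_sum, ← mul_sum]
          linarith [hle q, hle' q hq]
  calc collForm i y h ≤ ∑ q ∈ collisions (modelI d),
        (3 * ∑ η ∈ level d M (modelI d) i, collRate y q η * (f (collide η y q) - f η) ^ 2 +
        6 * U) := sum_le_sum hq
    _ = _ := by
        rw [sum_add_distrib, ← mul_sum, sum_const, nsmul_eq_mul, collForm]; ring

end General

/-! ### A Poincaré inequality on finite weighted graphs -/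

section Graph

lemma sub_eq_sum_darts {Ω : Type*} {G : SimpleGraph Ω} (F : Ω → ℝ) {a b : Ω} (p : G.Walk a b) :
    F b - F a = ((p.darts.map SimpleGraph.Dart.toProd).map fun e => F e.2 - F e.1).sum := by
  induction p with
  | nil => simp
  | cons h p ih =>
    simp only [SimpleGraph.Walk.darts_cons, List.map_cons, List.sum_cons, ← ih]
    ring

variable {Ω : Type*} [Fintype Ω] [DecidableEq Ω]

/-- Cauchy-Schwarz along a self-avoiding path, which has fewer steps than the graph has vertices. -/
lemma mul_sq_sub_le_of_reachable {G : SimpleGraph Ω} (F : Ω → ℝ) {A : Ω → Ω → ℝ} {t : ℝ}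
    (ht : 0 ≤ t) (hA0 : ∀ u v, 0 ≤ A u v)
    (hA : ∀ u v, G.Adj u v → t * (F v - F u) ^ 2 ≤ A u v) {a b : Ω} (h : G.Reachable a b) :
    t * (F b - F a) ^ 2 ≤ Fintype.card Ω * ∑ u, ∑ v, A u v := by
  obtain ⟨p, hp⟩ := h.exists_isPath
  set l := p.darts.map SimpleGraph.Dart.toProd with hl
  have hnd : l.Nodup := by
    refine List.Nodup.map ?_ (SimpleGraph.Walk.darts_nodup_of_support_nodup hp.support_nodup)
    exact SimpleGraph.Dart.toProd_injective
  have hlen : (l.toFinset.card : ℝ) ≤ Fintype.card Ω := by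
    have h1 : l.toFinset.card ≤ Fintype.card Ω := by
      rw [List.toFinset_card_of_nodup hnd, hl, List.length_map, SimpleGraph.Walk.length_darts]
      exact hp.length_lt.le
    exact_mod_cast h1
  have hsum : F b - F a = ∑ e ∈ l.toFinset, (F e.2 - F e.1) := by
    rw [List.sum_toFinset _ hnd]
    exact sub_eq_sum_darts F p
  calc t * (F b - F a) ^ 2 ≤ t * (l.toFinset.card * ∑ e ∈ l.toFinset, (F e.2 - F e.1) ^ 2) := by
        rw [hsum]
        exact mul_le_mul_of_nonneg_left sq_sum_le_card_mul_sum_sq ht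
    _ = l.toFinset.card * ∑ e ∈ l.toFinset, t * (F e.2 - F e.1) ^ 2 := by rw [← mul_sum]; ring
    _ ≤ l.toFinset.card * ∑ e ∈ l.toFinset, A e.1 e.2 := by
        refine mul_le_mul_of_nonneg_left (sum_le_sum fun e he => ?_) (Nat.cast_nonneg _)
        rw [List.mem_toFinset, hl, List.mem_map] at he
        obtain ⟨δ, _, rfl⟩ := he
        exact hA _ _ δ.adj
    _ ≤ l.toFinset.card * ∑ e : Ω × Ω, A e.1 e.2 :=
        mul_le_mul_of_nonneg_left
          (sum_le_sum_of_subset_of_nonneg (subset_univ _) fun _ _ _ => hA0 _ _) (Nat.cast_nonneg _)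
    _ ≤ Fintype.card Ω * ∑ u, ∑ v, A u v := by
        rw [Fintype.sum_prod_type]
        exact mul_le_mul_of_nonneg_right hlen (sum_nonneg fun _ _ => sum_nonneg fun _ _ => hA0 _ _)

/-- A Poincaré inequality for a weight `W` whose superlevel sets are connected: two states
`a`, `b` are joined by a path, of length at most the number of states, along which `W` is at
least `min (W a) (W b)`. -/
lemma sum_weighted_sq_sub_le (W : Ω → ℕ) (F : Ω → ℝ) {B : Ω → Ω → ℝ} {r : Ω → Ω → Prop}
    (hB0 : ∀ u v, 0 ≤ B u v) (hB : ∀ u v, r u v → W u * (F v - F u) ^ 2 ≤ B u v)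
    (hconn : ∀ a b, (SimpleGraph.fromRel fun u v =>
      r u v ∧ min (W a) (W b) ≤ W u ∧ min (W a) (W b) ≤ W v).Reachable a b) :
    ∑ a, ∑ b, (W a * W b : ℝ) * (F b - F a) ^ 2 ≤
      4 * (Fintype.card Ω : ℝ) ^ 2 * (∑ a, (W a : ℝ)) * ∑ u, ∑ v, B u v := by
  set K : ℝ := 2 * Fintype.card Ω * ∑ u, ∑ v, B u v with hK
  have hmin : ∀ a b, ((min (W a) (W b) : ℕ) : ℝ) * (F b - F a) ^ 2 ≤ K := by
    intro a b
    have := mul_sq_sub_le_of_reachable F (A := fun u v => B u v + B v u)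
      (Nat.cast_nonneg (min (W a) (W b))) (fun u v => add_nonneg (hB0 u v) (hB0 v u)) ?_
      (hconn a b)
    · refine this.trans_eq ?_
      have hc : ∑ u, ∑ v, B v u = ∑ u, ∑ v, B u v := sum_comm
      simp only [sum_add_distrib, hc, hK]
      ring
    · intro u v huv
      rw [SimpleGraph.fromRel_adj] at huv
      rcases huv.2 with ⟨hr, hu, -⟩ | ⟨hr, hv, -⟩
      · have h1 : ((min (W a) (W b) : ℕ) : ℝ) ≤ W u := by exact_mod_cast hu
        have h2 := mul_le_mul_of_nonneg_right h1 (sq_nonneg (F v - F u))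
        have := hB u v hr
        have := hB0 v u
        linarith
      · have h1 : ((min (W a) (W b) : ℕ) : ℝ) ≤ W v := by exact_mod_cast hv
        have h2 := mul_le_mul_of_nonneg_right h1 (sq_nonneg (F v - F u))
        have := hB v u hr
        have := hB0 u v
        nlinarith
  have hK0 : 0 ≤ K := by
    have : 0 ≤ ∑ u, ∑ v, B u v := sum_nonneg fun _ _ => sum_nonneg fun _ _ => hB0 _ _
    positivity
  calc ∑ a, ∑ b, (W a * W b : ℝ) * (F b - F a) ^ 2
      ≤ ∑ a, ∑ b, ((W a : ℝ) + W b) * K := by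
        refine sum_le_sum fun a _ => sum_le_sum fun b _ => ?_
        have hmm : (W a * W b : ℝ) = ((max (W a) (W b) : ℕ) : ℝ) * ((min (W a) (W b) : ℕ) : ℝ) := by
          exact_mod_cast (max_mul_min (W a) (W b)).symm
        have hmax : ((max (W a) (W b) : ℕ) : ℝ) ≤ (W a : ℝ) + W b := by
          exact_mod_cast max_le_add_of_nonneg (Nat.zero_le _) (Nat.zero_le _)
        rw [hmm, mul_assoc]
        exact mul_le_mul hmax (hmin a b) (by positivity) (by positivity)
    _ = _ := by
        simp only [← sum_mul, sum_add_distrib, sum_const, card_univ, nsmul_eq_mul, ← mul_sum, hK]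
        ring

end Graph

/-! ### The number of configurations with given particle numbers -/

section Slices

variable {d M : ℕ} {V : Finset (Fin d → ℝ)}

/-- The number of configurations with `n v` particles of velocity `v`, for each `v`. -/
def sliceCard (d M : ℕ) {V : Finset (Fin d → ℝ)} (n : V → ℕ) : ℕ :=
  (univ.filter fun η : Config d M V => cnt η = n).card

lemma sliceCard_eq_prod_choose (n : V → ℕ) :
    sliceCard d M n = ∏ v, (Fintype.card (Box d M)).choose (n v) := by
  have h : (Fintype.piFinset fun v : V => powersetCard (n v) (univ : Finset (Box d M))).card =
      ∏ v, (Fintype.card (Box d M)).choose (n v) := by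
    simp only [Fintype.card_piFinset, card_powersetCard, card_univ]
  rw [← h, sliceCard]
  refine card_nbij' (fun η v => univ.filter fun x => η x v = true)
    (fun s x v => decide (x ∈ s v)) ?_ ?_ ?_ ?_
  · intro η hη
    refine mem_coe.2 (Fintype.mem_piFinset.2 fun v => mem_powersetCard.2 ⟨subset_univ _, ?_⟩)
    exact congrFun (mem_filter.1 (mem_coe.1 hη)).2 v
  · intro s hs
    have hs' := Fintype.mem_piFinset.1 (mem_coe.1 hs)
    refine mem_coe.2 (mem_filter.2 ⟨mem_univ _, funext fun v => ?_⟩)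
    simpa [cnt] using (mem_powersetCard.1 (hs' v)).2
  · intro η _
    funext x v
    simp
  · intro s _
    funext v
    ext x
    simp

lemma cnt_le_card (η : Config d M V) (v : V) : cnt η v ≤ Fintype.card (Box d M) :=
  card_le_univ _

/-- Log-concavity of the binomial coefficients. -/
lemma choose_mul_choose_le (N : ℕ) {p q : ℕ} (h : q < p) :
    N.choose p * N.choose q ≤ N.choose (p - 1) * N.choose (q + 1) := by
  obtain ⟨p, rfl⟩ : ∃ p', p = p' + 1 := ⟨p - 1, by omega⟩
  rw [Nat.add_sub_cancel]
  refine Nat.le_of_mul_le_mul_right (c := (p + 1) * (q + 1)) ?_ (by positivity)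
  calc N.choose (p + 1) * N.choose q * ((p + 1) * (q + 1))
      = (N.choose (p + 1) * (p + 1)) * (N.choose q * (q + 1)) := by ring
    _ = (N.choose p * N.choose q) * ((N - p) * (q + 1)) := by
        rw [Nat.choose_succ_right_eq]; ring
    _ ≤ (N.choose p * N.choose q) * ((N - q) * (p + 1)) := by
        gcongr <;> omega
    _ = N.choose p * (N.choose q * (N - q)) * (p + 1) := by ring
    _ = N.choose p * N.choose (q + 1) * ((p + 1) * (q + 1)) := by
        rw [← Nat.choose_succ_right_eq]; ring

/-- The permutations that bring the occupation variables `(x₀, v₀), …, (x₃, v₃)` to the site `y`. -/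
def gather (y : Box d M) (q : V × V × V × V) (x : Box d M × Box d M × Box d M × Box d M) :
    V → Equiv.Perm (Box d M) := fun v =>
  if v = q.1 then Equiv.swap y x.1 else if v = q.2.1 then Equiv.swap y x.2.1
  else if v = q.2.2.1 then Equiv.swap y x.2.2.1 else Equiv.swap y x.2.2.2

lemma exists_isActive_gather (y : Box d M) {q : V × V × V × V} (h01 : q.1 ≠ q.2.1)
    (h02 : q.1 ≠ q.2.2.1) (h03 : q.1 ≠ q.2.2.2) (h12 : q.2.1 ≠ q.2.2.1) (h13 : q.2.1 ≠ q.2.2.2)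
    (h23 : q.2.2.1 ≠ q.2.2.2) {η : Config d M V} (h0 : 0 < cnt η q.1) (h1 : 0 < cnt η q.2.1)
    (h2 : cnt η q.2.2.1 < Fintype.card (Box d M)) (h3 : cnt η q.2.2.2 < Fintype.card (Box d M)) :
    ∃ x, IsActive y q (act (gather y q x) η) := by
  have hpos : ∀ v, 0 < cnt η v → ∃ x, η x v = true := by
    intro v hv
    obtain ⟨x, hx⟩ := card_pos.1 hv
    exact ⟨x, (mem_filter.1 hx).2⟩
  have hlt : ∀ v, cnt η v < Fintype.card (Box d M) → ∃ x, η x v = false := by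
    intro v hv
    by_contra! hcon
    refine hv.ne ?_
    rw [cnt, ← card_univ]
    congr 1
    exact filter_true_of_mem fun x _ => by simpa using hcon x
  obtain ⟨x0, hx0⟩ := hpos _ h0
  obtain ⟨x1, hx1⟩ := hpos _ h1
  obtain ⟨x2, hx2⟩ := hlt _ h2
  obtain ⟨x3, hx3⟩ := hlt _ h3
  refine ⟨(x0, x1, x2, x3), ?_, ?_, ?_, ?_⟩
  · simpa [act, gather] using hx0
  · simpa [act, gather, h01.symm] using hx1
  · simpa [act, gather, h02.symm, h12.symm] using hx2
  · simpa [act, gather, h03.symm, h13.symm, h23.symm] using hx3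

/-- A collision that is possible somewhere is active at the site `y` for a proportion at least
`N⁻⁴` of the configurations with the same particle numbers, where `N` is the number of sites. -/
lemma sliceCard_le_mul_card_isActive (y : Box d M) {q : V × V × V × V} (h01 : q.1 ≠ q.2.1)
    (h02 : q.1 ≠ q.2.2.1) (h03 : q.1 ≠ q.2.2.2) (h12 : q.2.1 ≠ q.2.2.1) (h13 : q.2.1 ≠ q.2.2.2)
    (h23 : q.2.2.1 ≠ q.2.2.2) {n : V → ℕ} (h0 : 0 < n q.1) (h1 : 0 < n q.2.1)
    (h2 : n q.2.2.1 < Fintype.card (Box d M)) (h3 : n q.2.2.2 < Fintype.card (Box d M)) :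
    sliceCard d M n ≤ Fintype.card (Box d M) ^ 4 *
      (univ.filter fun η : Config d M V => cnt η = n ∧ IsActive y q η).card := by
  set T := univ.filter fun η : Config d M V => cnt η = n ∧ IsActive y q η with hT
  have hsub : (univ.filter fun η : Config d M V => cnt η = n) ⊆
      (univ : Finset (Box d M × Box d M × Box d M × Box d M)).biUnion
        fun x => T.image (act (gather y q x)⁻¹) := by
    intro η hη
    obtain rfl := (mem_filter.1 hη).2
    obtain ⟨x, hx⟩ := exists_isActive_gather y h01 h02 h03 h12 h13 h23 h0 h1 h2 h3
    refine mem_biUnion.2 ⟨x, mem_univ _, mem_image.2 ⟨_, ?_, act_inv_act (gather y q x) η⟩⟩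
    exact mem_filter.2 ⟨mem_univ _, cnt_act _ _, hx⟩
  refine (card_le_card hsub).trans ((card_biUnion_le_card_mul _ _ T.card
    fun x _ => card_image_le).trans_eq ?_)
  simp only [card_univ, Fintype.card_prod]
  ring

end Slices

/-! ### The graph of particle numbers in Model I -/

section States

variable {d M : ℕ}

lemma avgI_eq_iff_modelI (η ξ : Config d M (modelI d)) : avgI η = avgI ξ ↔
    ∑ j, cnt η (pos j) + ∑ j, cnt η (neg j) = ∑ j, cnt ξ (pos j) + ∑ j, cnt ξ (neg j) ∧
      ∀ k, cnt η (pos k) + cnt ξ (neg k) = cnt ξ (pos k) + cnt η (neg k) := by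
  have hmom : ∀ (η : Config d M (modelI d)) (k : Fin d),
      ∑ v : ↥(modelI d), (v : Fin d → ℝ) k * cnt η v = cnt η (pos k) - cnt η (neg k) := by
    intro η k
    rw [sum_modelI]
    simp [pos_apply, neg_apply, sub_eq_add_neg]
  rw [avgI_eq_iff, sum_modelI, sum_modelI]
  refine and_congr Iff.rfl (forall_congr' fun k => ?_)
  rw [hmom, hmom, sub_eq_sub_iff_add_eq_add]
  exact_mod_cast Iff.rfl

/-- The particle numbers after a collision `(e_j, -e_j) → (e_l, -e_l)`. -/
def move (j l : Fin d) (n : ↥(modelI d) → ℕ) (v : ↥(modelI d)) : ℕ :=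
  if v = pos j ∨ v = neg j then n v - 1 else if v = pos l ∨ v = neg l then n v + 1 else n v

/-- The collision `(e_j, -e_j) → (e_l, -e_l)`. -/
def pairColl (j l : Fin d) : ↥(modelI d) × ↥(modelI d) × ↥(modelI d) × ↥(modelI d) :=
  (pos j, neg j, pos l, neg l)

lemma pairColl_mem (j l : Fin d) : pairColl j l ∈ collisions (modelI d) := by
  simp [collisions, pairColl, pos, neg]

lemma IsActive.cnt_collide_pairColl {y : Box d M} {j l : Fin d} (hjl : j ≠ l)
    {η : Config d M (modelI d)} (h : IsActive y (pairColl j l) η) :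
    cnt (LatticeGas.collide η y (pairColl j l)) = move j l (cnt η) := by
  funext v
  have hv : (cnt (LatticeGas.collide η y (pairColl j l)) v : ℝ) = cnt η v +
      ((if v = pos l then 1 else 0) + (if v = neg l then 1 else 0)
        - (if v = pos j then 1 else 0) - (if v = neg j then 1 else 0)) :=
    h.cnt_collide (pos_ne_neg j j) (pos_ne_neg l l) v
  have hv' : cnt (LatticeGas.collide η y (pairColl j l)) v +
      ((if v = pos j then 1 else 0) + (if v = neg j then 1 else 0)) =
      cnt η v + ((if v = pos l then 1 else 0) + (if v = neg l then 1 else 0)) := by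
    have hcast : ((cnt (LatticeGas.collide η y (pairColl j l)) v +
        ((if v = pos j then 1 else 0) + (if v = neg j then 1 else 0)) : ℕ) : ℝ) =
        ((cnt η v + ((if v = pos l then 1 else 0) + (if v = neg l then 1 else 0)) : ℕ) : ℝ) := by
      push_cast
      rw [hv]
      ring
    exact_mod_cast hcast
  obtain ⟨k, rfl | rfl⟩ := eq_pos_or_neg v <;> by_cases hkj : k = j <;> by_cases hkl : k = l <;>
    simp only [move, pos_inj, neg_inj, pos_ne_neg, neg_ne_pos, hkj, hkl, hjl, hjl.symm, or_false,
      false_or, if_true, if_false] at hv' ⊢ <;>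
    omega

/-- The collision `(e_j, -e_j) → (e_l, -e_l)` is possible for some configuration with particle
numbers `n`. -/
def CanMove (M : ℕ) (j l : Fin d) (n : ↥(modelI d) → ℕ) : Prop :=
  j ≠ l ∧ 0 < n (pos j) ∧ 0 < n (neg j) ∧ n (pos l) < Fintype.card (Box d M) ∧
    n (neg l) < Fintype.card (Box d M)

lemma exists_cnt_eq_move {i : Fin (d + 1) → ℝ} {j l : Fin d} {η : Config d M (modelI d)}
    (hη : η ∈ level d M (modelI d) i) (h : CanMove M j l (cnt η)) :
    ∃ ξ ∈ level d M (modelI d) i, cnt ξ = move j l (cnt η) := by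
  obtain ⟨hjl, h0, h1, h2, h3⟩ := h
  let y : Box d M := fun _ => ⟨0, by simp⟩
  obtain ⟨x, hx⟩ := exists_isActive_gather y (q := pairColl j l) (pos_ne_neg j j)
    (by simpa [pairColl] using hjl) (pos_ne_neg j l) (neg_ne_pos j l)
    (by simpa [pairColl] using hjl) (pos_ne_neg l l) h0 h1 h2 h3
  exact ⟨_, hx.collide_mem_level (pos_ne_neg j j) (pos_ne_neg l l) (pairColl_mem j l)
    ((act_mem_level _).2 hη), by rw [hx.cnt_collide_pairColl hjl, cnt_act]⟩

/-- The possible particle numbers in a level set. -/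
abbrev States (M : ℕ) (i : Fin (d + 1) → ℝ) : Type :=
  ↥((level d M (modelI d) i).image (cnt : Config d M (modelI d) → ↥(modelI d) → ℕ))

lemma card_states_le (hd : 1 ≤ d) (i : Fin (d + 1) → ℝ) :
    Fintype.card (States M i) ≤ (Fintype.card (Box d M) + 1) ^ (d - 1) := by
  let j₀ : Fin d := ⟨0, hd⟩
  have hle : ∀ (u : States M i) v, u.1 v < Fintype.card (Box d M) + 1 := by
    rintro ⟨u, hu⟩ v
    obtain ⟨η, -, rfl⟩ := mem_image.1 hu
    exact Nat.lt_succ_of_le (cnt_le_card η v)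
  let φ : States M i → ({j : Fin d // j ≠ j₀} → Fin (Fintype.card (Box d M) + 1)) :=
    fun u j => ⟨u.1 (pos j), hle u _⟩
  have hφ : Function.Injective φ := by
    rintro ⟨u, hu⟩ ⟨w, hw⟩ huw
    obtain ⟨η, hη, rfl⟩ := mem_image.1 hu
    obtain ⟨ξ, hξ, rfl⟩ := mem_image.1 hw
    rw [mem_level] at hη hξ
    obtain ⟨htot, hmom⟩ := (avgI_eq_iff_modelI η ξ).1 (hη.trans hξ.symm)
    have hp : ∀ j, j ≠ j₀ → cnt η (pos j) = cnt ξ (pos j) := fun j hj =>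
      congrArg Fin.val (congrFun huw ⟨j, hj⟩)
    have hn : ∀ j, j ≠ j₀ → cnt η (neg j) = cnt ξ (neg j) := fun j hj => by
      have := hp j hj
      have := hmom j
      omega
    rw [← add_sum_erase _ _ (mem_univ j₀), ← add_sum_erase _ (fun j => cnt η (neg j)) (mem_univ j₀),
      ← add_sum_erase _ (fun j => cnt ξ (pos j)) (mem_univ j₀),
      ← add_sum_erase _ (fun j => cnt ξ (neg j)) (mem_univ j₀),
      sum_congr rfl fun j hj => hp j (ne_of_mem_erase hj),
      sum_congr rfl fun j hj => hn j (ne_of_mem_erase hj)] at htot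
    have hj₀ := hmom j₀
    refine Subtype.ext (funext fun v => ?_)
    obtain ⟨j, rfl | rfl⟩ := eq_pos_or_neg v <;> by_cases hj : j = j₀
    · subst hj; change cnt η (pos j₀) = cnt ξ (pos j₀); omega
    · exact hp j hj
    · subst hj; change cnt η (neg j₀) = cnt ξ (neg j₀); omega
    · exact hn j hj
  refine (Fintype.card_le_of_injective φ hφ).trans_eq ?_
  simp

/-- Moving one pair of particles of `a` and one of `b` towards each other does not decrease the
product of the numbers of configurations: the weights are `M`-concave. -/
lemma sliceCard_mul_le {a b : ↥(modelI d) → ℕ} {j l : Fin d}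
    (h0 : b (pos j) < a (pos j)) (h1 : b (neg j) < a (neg j))
    (h2 : a (pos l) < b (pos l)) (h3 : a (neg l) < b (neg l)) :
    sliceCard d M a * sliceCard d M b ≤
      sliceCard d M (move j l a) * sliceCard d M (move l j b) := by
  have hjl : j ≠ l := by rintro rfl; omega
  simp only [sliceCard_eq_prod_choose, ← prod_mul_distrib]
  refine prod_le_prod (fun _ _ => Nat.zero_le _) fun v _ => ?_
  obtain ⟨k, rfl | rfl⟩ := eq_pos_or_neg v <;>
    simp only [move, pos_inj, neg_inj, pos_ne_neg, neg_ne_pos, or_false, false_or] <;>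
    by_cases hkj : k = j
  · subst hkj
    simpa [hjl] using choose_mul_choose_le _ h0
  · by_cases hkl : k = l
    · subst hkl
      simpa [hkj, mul_comm] using choose_mul_choose_le (Fintype.card (Box d M)) h2
    · simp [hkj, hkl]
  · subst hkj
    simpa [hjl] using choose_mul_choose_le _ h1
  · by_cases hkl : k = l
    · subst hkl
      simpa [hkj, mul_comm] using choose_mul_choose_le (Fintype.card (Box d M)) h3
    · simp [hkj, hkl]

end States

/-! ### Connectivity of superlevel sets -/

section Connectivity

variable {d M : ℕ}

/-- Adjacency of two states: one collision leads from `u` to `w`. -/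
def StepRel {i : Fin (d + 1) → ℝ} (u w : States M i) : Prop :=
  ∃ j l, CanMove M j l u.1 ∧ w.1 = move j l u.1

lemma states_le_card {i : Fin (d + 1) → ℝ} (u : States M i) (v : ↥(modelI d)) :
    u.1 v ≤ Fintype.card (Box d M) := by
  obtain ⟨η, -, hη⟩ := mem_image.1 u.2
  rw [← hη]
  exact cnt_le_card η v

lemma exists_move_state {i : Fin (d + 1) → ℝ} (u : States M i) {j l : Fin d}
    (h : CanMove M j l u.1) : ∃ w : States M i, w.1 = move j l u.1 ∧ StepRel u w := by
  obtain ⟨u, hu⟩ := u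
  obtain ⟨η, hη, rfl⟩ := mem_image.1 hu
  obtain ⟨ξ, hξ, hc⟩ := exists_cnt_eq_move hη h
  exact ⟨⟨cnt ξ, mem_image_of_mem _ hξ⟩, hc, j, l, h, hc⟩

/-- Two distinct states differ by a surplus of pairs in one direction and a deficit in another. -/
lemma exists_surplus_deficit {i : Fin (d + 1) → ℝ} {a b : States M i} (hab : a ≠ b) :
    ∃ j l, b.1 (pos j) < a.1 (pos j) ∧ b.1 (neg j) < a.1 (neg j) ∧
      a.1 (pos l) < b.1 (pos l) ∧ a.1 (neg l) < b.1 (neg l) := by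
  obtain ⟨a, ha⟩ := a
  obtain ⟨b, hb⟩ := b
  obtain ⟨η, hη, rfl⟩ := mem_image.1 ha
  obtain ⟨ξ, hξ, rfl⟩ := mem_image.1 hb
  rw [mem_level] at hη hξ
  obtain ⟨htot, hmom⟩ := (avgI_eq_iff_modelI η ξ).1 (hη.trans hξ.symm)
  rw [← sum_add_distrib, ← sum_add_distrib] at htot
  have key : ∀ p q : Fin d → ℕ, ∑ j, p j = ∑ j, q j → (∃ j, p j ≠ q j) → ∃ j, q j < p j := by
    rintro p q h ⟨k, hk⟩
    by_contra! hcon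
    exact hk ((sum_eq_sum_iff_of_le fun j _ => hcon j).1 h k (mem_univ k))
  have hne : ∃ j, cnt η (pos j) + cnt η (neg j) ≠ cnt ξ (pos j) + cnt ξ (neg j) := by
    by_contra! hcon
    refine hab (Subtype.ext (funext fun v => ?_))
    obtain ⟨j, rfl | rfl⟩ := eq_pos_or_neg v <;>
    · have h1 := hcon j
      have h2 := hmom j
      simp only
      omega
  obtain ⟨j, hj⟩ := key _ _ htot hne
  obtain ⟨l, hl⟩ := key _ _ htot.symm (by simpa only [ne_comm] using hne)
  have h1 := hmom j
  have h2 := hmom l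
  refine ⟨j, l, ?_, ?_, ?_, ?_⟩ <;> simp only <;> omega

/-- The total variation of the difference of two particle numbers. -/
def gap (a b : ↥(modelI d) → ℕ) : ℕ := ∑ v, ((a v - b v) + (b v - a v))

lemma gap_comm (a b : ↥(modelI d) → ℕ) : gap a b = gap b a :=
  sum_congr rfl fun _ _ => add_comm _ _

lemma gap_move_lt {a b : ↥(modelI d) → ℕ} {j l : Fin d}
    (h0 : b (pos j) < a (pos j)) (h1 : b (neg j) < a (neg j))
    (h2 : a (pos l) < b (pos l)) (h3 : a (neg l) < b (neg l)) : gap (move j l a) b < gap a b := by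
  have hjl : j ≠ l := by rintro rfl; omega
  refine sum_lt_sum (fun v _ => ?_) ⟨pos j, mem_univ _, ?_⟩
  · unfold move
    split_ifs with hv hv'
    · rcases hv with rfl | rfl <;> omega
    · rcases hv' with rfl | rfl <;> omega
    · exact le_rfl
  · simp only [move, true_or, if_true]
    omega

/-- Superlevel sets of the number of configurations are connected: by `M`-concavity one of two
distinct states can be moved towards the other without leaving the superlevel set. -/
lemma reachable_superlevel {i : Fin (d + 1) → ℝ} (t : ℕ) : ∀ (k : ℕ) (a b : States M i),
    gap a.1 b.1 ≤ k → t ≤ sliceCard d M a.1 → t ≤ sliceCard d M b.1 →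
    (SimpleGraph.fromRel fun u w : States M i =>
      StepRel u w ∧ t ≤ sliceCard d M u.1 ∧ t ≤ sliceCard d M w.1).Reachable a b := by
  intro k
  induction k with
  | zero =>
    intro a b hk _ _
    by_cases hab : a = b
    · rw [hab]
    obtain ⟨j, l, h0, h1, h2, h3⟩ := exists_surplus_deficit hab
    have := gap_move_lt h0 h1 h2 h3
    omega
  | succ k ih =>
    intro a b hk ha hb
    by_cases hab : a = b
    · rw [hab]
    obtain ⟨j, l, h0, h1, h2, h3⟩ := exists_surplus_deficit hab
    have hjl : j ≠ l := by rintro rfl; omega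
    obtain ⟨a', ha', hra⟩ := exists_move_state a (j := j) (l := l)
      ⟨hjl, by omega, by omega, h2.trans_le (states_le_card b _), h3.trans_le (states_le_card b _)⟩
    obtain ⟨b', hb', hrb⟩ := exists_move_state b (j := l) (l := j)
      ⟨hjl.symm, by omega, by omega, h0.trans_le (states_le_card a _),
        h1.trans_le (states_le_card a _)⟩
    have hmul := sliceCard_mul_le (M := M) h0 h1 h2 h3
    rw [← ha', ← hb'] at hmul
    have hga := gap_move_lt h0 h1 h2 h3
    have hgb := gap_move_lt (a := b.1) (b := a.1) h2 h3 h0 h1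
    rw [← ha'] at hga
    rw [← hb', gap_comm, gap_comm b.1] at hgb
    by_cases hta : t ≤ sliceCard d M a'.1
    · have hadj : (SimpleGraph.fromRel fun u w : States M i =>
          StepRel u w ∧ t ≤ sliceCard d M u.1 ∧ t ≤ sliceCard d M w.1).Adj a a' := by
        rw [SimpleGraph.fromRel_adj]
        exact ⟨by rintro rfl; exact lt_irrefl _ hga, Or.inl ⟨hra, ha, hta⟩⟩
      exact hadj.reachable.trans (ih a' b (by omega) hta hb)
    · have htb : t ≤ sliceCard d M b'.1 := by
        by_contra htb
        have h4 : sliceCard d M a'.1 * sliceCard d M b'.1 < t * t :=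
          Nat.mul_lt_mul'' (not_le.1 hta) (not_le.1 htb)
        exact absurd ((Nat.mul_le_mul ha hb).trans hmul) (not_le.2 h4)
      have hadj : (SimpleGraph.fromRel fun u w : States M i =>
          StepRel u w ∧ t ≤ sliceCard d M u.1 ∧ t ≤ sliceCard d M w.1).Adj b b' := by
        rw [SimpleGraph.fromRel_adj]
        exact ⟨by rintro rfl; exact lt_irrefl _ hgb, Or.inl ⟨hrb, hb, htb⟩⟩
      exact (ih a b' (by omega) ha htb).trans hadj.reachable.symm

end Connectivity

/-! ### The spectral gap -/

section Gap

variable {d M : ℕ}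

lemma card_level_filter (i : Fin (d + 1) → ℝ) (u : States M i) :
    ((level d M (modelI d) i).filter fun η => cnt η = u.1).card = sliceCard d M u.1 := by
  obtain ⟨ξ, hξ, hξu⟩ := mem_image.1 u.2
  rw [sliceCard]
  congr 1
  ext η
  simp only [mem_filter, mem_univ, true_and, and_iff_right_iff_imp]
  exact fun h => (mem_level_iff_of_cnt_eq (h.trans hξu.symm) i).2 hξ

lemma sum_level_comp_cnt (i : Fin (d + 1) → ℝ) (φ : (↥(modelI d) → ℕ) → ℝ) :
    ∑ η ∈ level d M (modelI d) i, φ (cnt η) =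
      ∑ u : States M i, (sliceCard d M u.1 : ℝ) * φ u.1 := by
  rw [sum_comp φ cnt, ← sum_coe_sort]
  exact sum_congr rfl fun u _ => by rw [card_level_filter, nsmul_eq_mul]

lemma sum_ite_and_le {α : Type*} [DecidableEq α] (s : Finset α) (x x' : α) {c : ℝ} (hc : 0 ≤ c) :
    ∑ u : s, ∑ w : s, (if x = u.1 ∧ x' = w.1 then c else 0) ≤ c := by
  have h : ∀ (x : α) {c : ℝ}, 0 ≤ c → ∑ w : s, (if x = w.1 then c else 0) ≤ c := by
    intro x c hc
    rw [sum_coe_sort s fun w => if x = w then c else 0, sum_ite_eq]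
    split_ifs
    · exact le_rfl
    · exact hc
  refine le_trans (sum_le_sum fun u _ => ?_) (h x hc)
  by_cases hu : x = u.1
  · simpa [hu] using h x' hc
  · simp [hu]

lemma sum_comm_four {α β γ : Type*} [Fintype γ] (s : Finset α) (t : Finset β)
    (X : γ → γ → α → β → ℝ) :
    ∑ u, ∑ w, ∑ q ∈ s, ∑ η ∈ t, X u w q η = ∑ q ∈ s, ∑ η ∈ t, ∑ u, ∑ w, X u w q η := by
  rw [sum_congr rfl fun u _ => sum_comm (s := univ) (t := s), sum_comm]
  refine sum_congr rfl fun q _ => ?_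
  rw [sum_congr rfl fun u _ => sum_comm (s := univ) (t := t), sum_comm]

/-- The spectral gap of the induced dynamics on particle numbers. Only the collisions at one site
`y` are needed. -/
lemma sum_sq_sub_comp_cnt_le (i : Fin (d + 1) → ℝ) (y : Box d M) (F : (↥(modelI d) → ℕ) → ℝ) :
    ∑ η ∈ level d M (modelI d) i, ∑ ξ ∈ level d M (modelI d) i, (F (cnt ξ) - F (cnt η)) ^ 2 ≤
      4 * (Fintype.card (States M i) : ℝ) ^ 2 * (level d M (modelI d) i).card *
        ((Fintype.card (Box d M) : ℝ) ^ 4 * collForm i y fun η => F (cnt η)) := by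
  set S := level d M (modelI d) i with hS
  set N : ℝ := ((Fintype.card (Box d M) : ℕ) : ℝ) with hN
  -- the part of the Dirichlet form carried by the collisions leading from `u` to `w`
  let B : States M i → States M i → ℝ := fun u w => N ^ 4 * ∑ q ∈ collisions (modelI d), ∑ η ∈ S,
    if cnt η = u.1 ∧ cnt (collide η y q) = w.1 then
      collRate y q η * (F (cnt (collide η y q)) - F (cnt η)) ^ 2 else 0
  have hterm : ∀ q (η : Config d M (modelI d)),
      0 ≤ collRate y q η * (F (cnt (collide η y q)) - F (cnt η)) ^ 2 := fun q η =>
    mul_nonneg (collRate_nonneg _ _ _) (sq_nonneg _)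
  have hterm' : ∀ q (η : Config d M (modelI d)) (u w : States M i),
      0 ≤ if cnt η = u.1 ∧ cnt (collide η y q) = w.1 then
        collRate y q η * (F (cnt (collide η y q)) - F (cnt η)) ^ 2 else 0 := by
    intro q η u w
    split_ifs
    · exact hterm q η
    · exact le_rfl
  have hB0 : ∀ u w, 0 ≤ B u w := fun u w =>
    mul_nonneg (by positivity) (sum_nonneg fun q _ => sum_nonneg fun η _ => hterm' q η u w)
  have hBsum : ∑ u, ∑ w, B u w ≤ N ^ 4 * collForm i y fun η => F (cnt η) := by
    simp only [B, ← mul_sum]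
    refine mul_le_mul_of_nonneg_left ?_ (by positivity)
    refine (sum_comm_four _ _ _).trans_le (sum_le_sum fun q _ => sum_le_sum fun η _ => ?_)
    exact sum_ite_and_le _ _ _ (hterm q η)
  have hB : ∀ u w : States M i, StepRel u w →
      (sliceCard d M u.1 : ℝ) * (F w.1 - F u.1) ^ 2 ≤ B u w := by
    rintro u w ⟨j, l, ⟨hjl, h0, h1, h2, h3⟩, hw⟩
    have hcard := sliceCard_le_mul_card_isActive y (q := pairColl j l) (pos_ne_neg j j)
      (by simpa [pairColl] using hjl) (pos_ne_neg j l) (neg_ne_pos j l)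
      (by simpa [pairColl] using hjl) (pos_ne_neg l l) h0 h1 h2 h3
    set T := univ.filter fun η : Config d M (modelI d) =>
      cnt η = u.1 ∧ IsActive y (pairColl j l) η with hT
    have hcard' : (sliceCard d M u.1 : ℝ) ≤ N ^ 4 * T.card := by
      rw [hN]; exact_mod_cast hcard
    calc (sliceCard d M u.1 : ℝ) * (F w.1 - F u.1) ^ 2 ≤ N ^ 4 * T.card * (F w.1 - F u.1) ^ 2 :=
          mul_le_mul_of_nonneg_right hcard' (sq_nonneg _)
      _ = N ^ 4 * ∑ η ∈ T, (F w.1 - F u.1) ^ 2 := by rw [sum_const, nsmul_eq_mul]; ring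
      _ ≤ N ^ 4 * ∑ η ∈ S, if cnt η = u.1 ∧ cnt (collide η y (pairColl j l)) = w.1 then
            collRate y (pairColl j l) η *
              (F (cnt (collide η y (pairColl j l))) - F (cnt η)) ^ 2 else 0 := by
          refine mul_le_mul_of_nonneg_left ?_ (by positivity)
          have hTS : T ⊆ S := by
            intro η hη
            obtain ⟨ξ, hξ, hξu⟩ := mem_image.1 u.2
            exact (mem_level_iff_of_cnt_eq ((mem_filter.1 hη).2.1.trans hξu.symm) i).2 hξ
          refine le_trans (sum_le_sum fun η hη => ?_)
            (sum_le_sum_of_subset_of_nonneg hTS fun η _ _ => hterm' _ η u w)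
          obtain ⟨hu, ha⟩ := (mem_filter.1 hη).2
          have hc : cnt (collide η y (pairColl j l)) = w.1 := by
            rw [ha.cnt_collide_pairColl hjl, hu, hw]
          rw [if_pos ⟨hu, hc⟩, hu, hc, collRate_eq, if_pos ha, one_mul]
      _ ≤ B u w := by
          refine mul_le_mul_of_nonneg_left ?_ (by positivity)
          exact single_le_sum (f := fun q => ∑ η ∈ S,
            if cnt η = u.1 ∧ cnt (collide η y q) = w.1 then
              collRate y q η * (F (cnt (collide η y q)) - F (cnt η)) ^ 2 else 0)
            (fun q _ => sum_nonneg fun η _ => hterm' q η u w) (pairColl_mem j l)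
  have hmain := sum_weighted_sq_sub_le (fun u : States M i => sliceCard d M u.1)
    (fun u => F u.1) hB0 hB fun a b =>
      reachable_superlevel _ _ a b le_rfl (min_le_left _ _) (min_le_right _ _)
  have hone : ∑ u : States M i, (sliceCard d M u.1 : ℝ) = S.card := by
    have := sum_level_comp_cnt (M := M) i fun _ => 1
    simpa using this.symm
  have hdouble : ∑ η ∈ S, ∑ ξ ∈ S, (F (cnt ξ) - F (cnt η)) ^ 2 =
      ∑ a : States M i, ∑ b : States M i,
        ((sliceCard d M a.1 : ℝ) * sliceCard d M b.1) * (F b.1 - F a.1) ^ 2 := by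
    rw [sum_congr rfl fun η _ => sum_level_comp_cnt i fun n => (F n - F (cnt η)) ^ 2,
      sum_level_comp_cnt i fun m => ∑ b : States M i, (sliceCard d M b.1 : ℝ) * (F b.1 - F m) ^ 2]
    simp only [mul_sum, mul_assoc]
  rw [hdouble]
  refine hmain.trans ?_
  rw [hone]
  exact mul_le_mul_of_nonneg_left hBsum (by positivity)

/-- The variance as a double sum over pairs. -/
lemma card_mul_sum_sq_sub_mean {α : Type*} (s : Finset α) (f : α → ℝ) :
    (s.card : ℝ) * ∑ a ∈ s, (f a - (s.card : ℝ)⁻¹ * ∑ b ∈ s, f b) ^ 2 =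
      (∑ a ∈ s, ∑ b ∈ s, (f b - f a) ^ 2) / 2 := by
  rcases s.eq_empty_or_nonempty with rfl | hs
  · simp
  have hc : (s.card : ℝ) ≠ 0 := by exact_mod_cast hs.card_ne_zero
  simp only [sub_sq, sum_add_distrib, sum_sub_distrib, sum_const, nsmul_eq_mul, ← mul_sum,
    ← sum_mul]
  field_simp
  ring

/-- The sum of squared deviations splits into the fluctuations within the orbits and those of the
orbit averages, which are functions of the particle numbers. -/
lemma sum_sq_sub_expect_le (i : Fin (d + 1) → ℝ) (hne : (level d M (modelI d) i).Nonempty)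
    (y : Box d M) (f : Config d M (modelI d) → ℝ) :
    ∑ η ∈ level d M (modelI d) i, (f η - expect i f) ^ 2 ≤
      3 * ∑ η ∈ level d M (modelI d) i, (f η - orbitAvg f η) ^ 2 +
        6 * (Fintype.card (States M i) : ℝ) ^ 2 * (Fintype.card (Box d M) : ℝ) ^ 4 *
          collForm i y (orbitAvg f) := by
  obtain ⟨F, hF⟩ := exists_orbitAvg_eq_comp_cnt f
  set S := level d M (modelI d) i with hS
  have hc : (0 : ℝ) < S.card := by exact_mod_cast hne.card_pos
  have h1 := card_mul_sum_sq_sub_mean S f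
  have h2 := sum_sq_sub_comp_cnt_le i y F
  simp only [← hF] at h2
  change _ ≤ 4 * (Fintype.card (States M i) : ℝ) ^ 2 * S.card *
        ((Fintype.card (Box d M) : ℝ) ^ 4 * collForm i y (orbitAvg f)) at h2
  set u := ∑ η ∈ S, (f η - orbitAvg f η) ^ 2 with hu
  have h3 : ∑ η ∈ S, ∑ ξ ∈ S, (f ξ - f η) ^ 2 ≤
      6 * S.card * u + 3 * ∑ η ∈ S, ∑ ξ ∈ S, (orbitAvg f ξ - orbitAvg f η) ^ 2 := by
    calc ∑ η ∈ S, ∑ ξ ∈ S, (f ξ - f η) ^ 2 ≤ ∑ η ∈ S, ∑ ξ ∈ S, (3 * (f ξ - orbitAvg f ξ) ^ 2 +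
          3 * (f η - orbitAvg f η) ^ 2 + 3 * (orbitAvg f ξ - orbitAvg f η) ^ 2) := by
          refine sum_le_sum fun η _ => sum_le_sum fun ξ _ => ?_
          set a := f ξ - orbitAvg f ξ
          set b := f η - orbitAvg f η
          set c := orbitAvg f ξ - orbitAvg f η
          have e : f ξ - f η = a - b + c := by ring
          rw [e]
          nlinarith [sq_nonneg (a + b), sq_nonneg (a - c), sq_nonneg (b + c)]
      _ = _ := by
          simp only [sum_add_distrib, sum_const, nsmul_eq_mul, ← mul_sum, hu]
          ring
  refine le_of_mul_le_mul_left ?_ hc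
  change (S.card : ℝ) * ∑ η ∈ S, (f η - (S.card : ℝ)⁻¹ * ∑ η ∈ S, f η) ^ 2 ≤ _
  rw [h1]
  nlinarith

end Gap

section Main

variable {d M : ℕ}

/-! ### Polynomial bound on the inverse gap -/

lemma card_box (d M : ℕ) : Fintype.card (Box d M) = (2 * M + 1) ^ d := by
  have h : ((M : ℤ) + 1 + M).toNat = 2 * M + 1 := by omega
  simp [Box, h]

/-- The loss of the path argument is at most `(2 * N) ^ (2 * d + 2)`, with `N ≤ 3 ^ d * M ^ d` the
number of sites; together with the exclusion rate `M ^ (-(d + 2))` this yields the exponent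
`2 + 3 * d + 2 * d ^ 2`. -/
lemma card_states_sq_mul_le (hd : 1 ≤ d) (hM : 1 ≤ M) (i : Fin (d + 1) → ℝ) :
    (Fintype.card (States M i) : ℝ) ^ 2 * (Fintype.card (Box d M) : ℝ) ^ 4 ≤
      (2 * 3 ^ d) ^ (2 * d + 2) * (M : ℝ) ^ (d * (2 * d + 2)) := by
  have hN : Fintype.card (Box d M) ≤ 3 ^ d * M ^ d := by
    rw [card_box, ← mul_pow]
    exact Nat.pow_le_pow_left (by omega) d
  have hN1 : 1 ≤ Fintype.card (Box d M) := by
    rw [card_box]; exact Nat.one_le_pow _ _ (by omega)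
  set N := Fintype.card (Box d M)
  have hR : Fintype.card (States M i) ≤ (2 * N) ^ (d - 1) :=
    (card_states_le hd i).trans (Nat.pow_le_pow_left (by omega) _)
  have h : Fintype.card (States M i) ^ 2 * N ^ 4 ≤
      (2 * 3 ^ d) ^ (2 * d + 2) * M ^ (d * (2 * d + 2)) := by
    calc Fintype.card (States M i) ^ 2 * N ^ 4
        ≤ ((2 * N) ^ (d - 1)) ^ 2 * (2 * N) ^ 4 := by
          gcongr
          omega
      _ = (2 * N) ^ (2 * d + 2) := by
          rw [← pow_mul, ← pow_add]
          congr 1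
          omega
      _ ≤ (2 * (3 ^ d * M ^ d)) ^ (2 * d + 2) := by gcongr
      _ = _ := by rw [← mul_assoc, mul_pow, ← pow_mul]
  exact_mod_cast h

/-- The Poincaré inequality for the lattice gas, for sums over a level set. -/
lemma sum_sq_sub_expect_le_dirichlet (hd : 1 ≤ d) (hM : 1 ≤ M) (i : Fin (d + 1) → ℝ)
    (hne : (level d M (modelI d) i).Nonempty) (f : Config d M (modelI d) → ℝ) :
    ∑ η ∈ level d M (modelI d) i, (f η - expect i f) ^ 2 ≤
      (96 * d ^ 2 + (2 * 3 ^ d) ^ (2 * d + 2) *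
        (36 + 1152 * (collisions (modelI d)).card * d ^ 2)) *
        (M : ℝ) ^ (2 + 3 * d + 2 * d ^ 2) *
          ∑ η ∈ level d M (modelI d) i, f η * -gen f η := by
  let y : Box d M := fun _ => ⟨0, by simp⟩
  have hM1 : (1 : ℝ) ≤ M := by exact_mod_cast hM
  have hN : 2 ≤ Fintype.card (Box d M) := by
    rw [card_box]
    calc 2 ≤ (2 * M + 1) ^ 1 := by rw [pow_one]; omega
      _ ≤ (2 * M + 1) ^ d := Nat.pow_le_pow_right (by omega) hd
  have hdir := sum_mul_neg_gen (M := M) i f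
  set E := ∑ η ∈ level d M (modelI d) i, f η * -gen f η
  have hcs : 0 ≤ ∑ y : Box d M, collForm i y f := sum_nonneg fun y _ => collForm_nonneg i y f
  have hpow : (0 : ℝ) < (M : ℝ) ^ (d + 2) := by positivity
  have hE0 : 0 ≤ E := by
    have := exForm_nonneg (M := M) i f
    rw [hdir]; positivity
  have hcoll : collForm i y f ≤ 2 * E := by
    have h1 := single_le_sum (f := fun y : Box d M => collForm i y f)
      (fun y _ => collForm_nonneg i y f) (mem_univ y)
    have h2 : 0 ≤ ((M : ℝ) ^ (d + 2))⁻¹ * (exForm i f / 4) := by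
      have := exForm_nonneg (M := M) i f
      positivity
    linarith
  have hex : exForm i f ≤ 4 * (M : ℝ) ^ (d + 2) * E := by
    have h2 : ((M : ℝ) ^ (d + 2))⁻¹ * (exForm i f / 4) ≤ E := by linarith
    rw [inv_mul_le_iff₀ hpow] at h2
    linarith
  have hu := sum_sq_sub_orbitAvg_le hN i f
  have hvar := sum_sq_sub_expect_le i hne y f
  have hc := collForm_le i y f (orbitAvg f)
  have hRN := card_states_sq_mul_le hd hM i
  set u := ∑ η ∈ level d M (modelI d) i, (f η - orbitAvg f η) ^ 2
  set K : ℝ := (2 * 3 ^ d) ^ (2 * d + 2) with hK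
  set Q : ℝ := ((collisions (modelI d)).card : ℝ) with hQ
  have hK0 : 0 ≤ K := by positivity
  have hQ0 : 0 ≤ Q := Nat.cast_nonneg _
  have hu' : u ≤ 32 * (d : ℝ) ^ 2 * (M : ℝ) ^ (d + 2) * E := by
    rw [card_modelI] at hu
    push_cast at hu
    calc u ≤ 2 * (2 * (d : ℝ)) ^ 2 * exForm i f := hu
      _ ≤ 2 * (2 * (d : ℝ)) ^ 2 * (4 * (M : ℝ) ^ (d + 2) * E) := by gcongr
      _ = _ := by ring
  have hp1 : (M : ℝ) ^ (d + 2) ≤ (M : ℝ) ^ (2 + 3 * d + 2 * d ^ 2) :=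
    pow_le_pow_right₀ hM1 (by nlinarith)
  have hp2 : (M : ℝ) ^ (d * (2 * d + 2)) ≤ (M : ℝ) ^ (2 + 3 * d + 2 * d ^ 2) :=
    pow_le_pow_right₀ hM1 (by nlinarith)
  have hp3 : (M : ℝ) ^ (d * (2 * d + 2)) * (M : ℝ) ^ (d + 2) =
      (M : ℝ) ^ (2 + 3 * d + 2 * d ^ 2) := by
    rw [← pow_add]; congr 1; ring
  set P := (M : ℝ) ^ (2 + 3 * d + 2 * d ^ 2)
  set p := (M : ℝ) ^ (d * (2 * d + 2)) with hp
  set m := (M : ℝ) ^ (d + 2)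
  calc ∑ η ∈ level d M (modelI d) i, (f η - expect i f) ^ 2
      ≤ 3 * u + 6 * ((Fintype.card (States M i) : ℝ) ^ 2 * (Fintype.card (Box d M) : ℝ) ^ 4) *
          collForm i y (orbitAvg f) := by linarith
    _ ≤ 3 * u + 6 * (K * p) * (3 * (2 * E) + 6 * Q * u) := by
        have h1 : collForm i y (orbitAvg f) ≤ 3 * (2 * E) + 6 * Q * u := by linarith
        have h2 := collForm_nonneg i y (orbitAvg f)
        gcongr
    _ ≤ 3 * (32 * (d : ℝ) ^ 2 * m * E) +
          6 * (K * p) * (3 * (2 * E) + 6 * Q * (32 * (d : ℝ) ^ 2 * m * E)) := by gcongr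
    _ = 96 * (d : ℝ) ^ 2 * m * E + 36 * K * p * E +
          1152 * K * Q * (d : ℝ) ^ 2 * (p * m) * E := by ring
    _ ≤ 96 * (d : ℝ) ^ 2 * P * E + 36 * K * P * E + 1152 * K * Q * (d : ℝ) ^ 2 * P * E := by
        rw [hp3]; gcongr
    _ = _ := by ring

lemma variance_le (hd : 1 ≤ d) (hM : 1 ≤ M) {i : Fin (d + 1) → ℝ}
    (hi : i ∈ possibleValues d M (modelI d)) (f : Config d M (modelI d) → ℝ) :
    variance i f ≤ (96 * d ^ 2 + (2 * 3 ^ d) ^ (2 * d + 2) *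
        (36 + 1152 * (collisions (modelI d)).card * d ^ 2)) *
        (M : ℝ) ^ (2 + 3 * d + 2 * d ^ 2) * innerL2 i f fun η => -gen f η := by
  obtain ⟨η, hη⟩ := hi
  have hne : (level d M (modelI d) i).Nonempty := ⟨η, mem_level.2 hη⟩
  have h := mul_le_mul_of_nonneg_left (sum_sq_sub_expect_le_dirichlet hd hM i hne f)
    (inv_nonneg.2 (Nat.cast_nonneg (level d M (modelI d) i).card))
  rw [mul_left_comm] at h
  exact h

end Main

end

end LatticeGas

theorem proposition6p1 (d : ℕ) (hd : 1 ≤ d) :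
    (∃ C₂ : ℝ, 0 < C₂ ∧
      ∀ M : ℕ, 1 ≤ M →
      ∀ i ∈ LatticeGas.possibleValues d M (LatticeGas.modelI d),
      ∀ f : LatticeGas.Config d M (LatticeGas.modelI d) → ℝ,
        LatticeGas.variance i f ≤
          C₂ * (M : ℝ) ^ (2 + 3 * d + 2 * d ^ 2) *
            LatticeGas.innerL2 i f (fun η => -LatticeGas.gen f η)) ∧
    (∃ C₀ κ : ℝ, 0 < C₀ ∧ 0 < κ ∧
      ∀ M : ℕ, 1 ≤ M →
      ∀ i ∈ LatticeGas.possibleValues d M (LatticeGas.modelI d),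
      ∃ C : ℝ, C ≤ C₀ * (M : ℝ) ^ κ ∧
        ∀ f : LatticeGas.Config d M (LatticeGas.modelI d) → ℝ,
          LatticeGas.variance i f ≤
            C * LatticeGas.innerL2 i f (fun η => -LatticeGas.gen f η)) := by
  have hC : (0 : ℝ) < 96 * d ^ 2 + (2 * 3 ^ d) ^ (2 * d + 2) *
      (36 + 1152 * (LatticeGas.collisions (LatticeGas.modelI d)).card * d ^ 2) := by positivity
  refine ⟨⟨_, hC, fun M hM i hi f => LatticeGas.variance_le hd hM hi f⟩,
    _, ((2 + 3 * d + 2 * d ^ 2 : ℕ) : ℝ), hC, by positivity, fun M hM i hi => ⟨_, le_rfl, ?_⟩⟩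
  intro f
  rw [Real.rpow_natCast]
  exact LatticeGas.variance_le hd hM hi f
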